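/- Let $n\ge 1$. A \emph{partition of type $B_n$} is a partition of $\{1,\dots,n\}\sqcup\{-1,\dots,-n\}$ in which at most one block (the \emph{zero block}) contains two opposite indices $i$ and $-i$, the other blocks coming in pairs of opposite blocks $\{C,-C\}$. A \emph{pointed partition of type $B_n$} is a partition of type $B_n$ together with the choice of one element of the zero block (if there is one) and, for each pair of opposite blocks $\{C,-C\}$, of a pair of opposite elements $p\in C$, $-p\in -C$; the chosen elements are called pointed. Let $\Pi^B_n$ be the set of pointed partitions of type $B_n$, ordered by $\pi\le\nu$ if the partition of $\pi$ refines that of $\nu$ and every pointed element of $\nu$ is a pointed element of $\pi$. It has a least element $\hat 0$. Let $\Pi^{B'}_n$ denote a maximal interval $[\hat 0,M]$ of $\Pi^B_n$, with $M$ a maximal element of $\Pi^B_n$ (all these intervals are isomorphic). A finite bounded poset $P$ is \emph{pure} if for all $x\le y$ all maximal chains of $[x,y]$ have the same length. A pure finite bounded poset $P$ is \emph{CL-shellable} if there are a poset $\Lambda$ and a map assigning a label in $\Lambda$ to every pair of a maximal chain of $P$ and a covering $x\lessdot y$ in this chain, such that labels of a common initial part of two maximal chains agree, and such that for all $x<y$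 and every maximal chain $r$ of $[\hat 0,x]$ the interval $[x,y]$, labelled as a continuation of $r$, has a unique maximal chain with weakly increasing labels, and the label sequence of this chain is lexicographically smaller than that of every other maximal chain of $[x,y]$. A pure finite bounded poset $P$ is \emph{Cohen--Macaulay} over a commutative ring $\mathbb{K}$ if for all $x<y$ in $P$ the reduced simplicial homology with coefficients in $\mathbb{K}$ of the order complex of the open interval $(x,y)$ vanishes in all degrees below the dimension of this complex. \textbf{Theorem.} For every $n\ge 1$ the posets $\Pi^{B'}_n$ are CL-shellable, and they are Cohen--Macaulay over $\mathbb{Z}$ and over every field. -/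

import Mathlib

/-! ### Pointed partitions of type `B` -/

/-- A pointed partition of type `B_n`. The set `[n] ⊔ [-n]` is modelled by `Fin n ⊕ Fin n`, the
opposite of an index being given by `Sum.swap`; a partition is recorded as an equivalence relation,
whose classes are the blocks, and the pointed elements are recorded as a set. -/
@[ext]
structure PointedPartitionB (n : ℕ) where
  /-- the underlying partition of `[n] ⊔ [-n]` -/
  part : Setoid (Fin n ⊕ Fin n)
  /-- the opposite of a block is a block -/
  part_swap : ∀ a b, part a b → part a.swap b.swap
  /-- at most one block (the zero block) contains opposite indices -/
  zero_block : ∀ a b, part a a.swap → part b b.swap → part a b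
  /-- the set of all pointed elements -/
  pointed : Set (Fin n ⊕ Fin n)
  /-- each block contains exactly one pointed element -/
  existsUnique_pointed : ∀ a, ∃! p, p ∈ pointed ∧ part a p
  /-- the pointed elements of two distinct opposite blocks are opposite -/
  pointed_swap : ∀ p ∈ pointed, ¬ part p p.swap → p.swap ∈ pointed

namespace PointedPartitionB

variable {n : ℕ}

/-- `π ≤ ν` if the partition of `π` refines that of `ν` and the pointed elements of `π` include
those of `ν`. -/
instance : PartialOrder (PointedPartitionB n) where
  le π ν := π.part ≤ ν.part ∧ ν.pointed ⊆ π.pointed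
  le_refl π := ⟨le_refl _, subset_refl _⟩
  le_trans _ _ _ h₁ h₂ := ⟨h₁.1.trans h₂.1, h₂.2.trans h₁.2⟩
  le_antisymm _ _ h₁ h₂ :=
    PointedPartitionB.ext (le_antisymm h₁.1 h₂.1) (Set.Subset.antisymm h₂.2 h₁.2)

/-- The minimal element: all blocks are singletons (there is no zero block). -/
instance : OrderBot (PointedPartitionB n) where
  bot :=
    { part := ⊥
      part_swap := by rintro a b rfl; rfl
      zero_block := by
        rintro (a | a) b h _ <;> exact absurd h (by simp)
      pointed := Set.univ
      existsUnique_pointed := fun a => ⟨a, ⟨trivial, rfl⟩, fun _ h => h.2.symm⟩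
      pointed_swap := fun _ _ _ => trivial }
  bot_le π := ⟨bot_le, Set.subset_univ _⟩

instance : Finite (PointedPartitionB n) := by
  refine Finite.of_injective
    (fun π : PointedPartitionB n => ((fun a b => π.part a b : _ → _ → Prop), π.pointed)) ?_
  intro π ν h
  simp only [Prod.mk.injEq] at h
  refine PointedPartitionB.ext (Setoid.ext fun a b => ?_) h.2
  exact iff_of_eq (congrFun (congrFun h.1 a) b)

end PointedPartitionB

/-! ### Chains and CL-shellability -/

/-- `x ⋖ c₁ ⋖ ⋯ ⋖ c_k = y`, where `c = [c₁, …, c_k]`. When `x ≤ y` these `c` are the maximal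
chains of the interval `[x, y]`, listed in increasing order with `x` omitted. -/
def IsMaximalChainBetween {P : Type*} [PartialOrder P] (x y : P) (c : List P) : Prop :=
  List.IsChain (· ⋖ ·) (x :: c) ∧ (x :: c).getLast (List.cons_ne_nil x c) = y

/-- For all `x ≤ y` the maximal chains between `x` and `y` have the same length. -/
def IsPurePoset (P : Type*) [PartialOrder P] : Prop :=
  ∀ (x y : P) (c d : List P),
    IsMaximalChainBetween x y c → IsMaximalChainBetween x y d → c.length = d.length

/-- The labels along the chain `c`, continuing the chain `r`. A chain-edge labelling assigns a
label to each pair of a maximal chain of the poset and a covering in it, such that two maximal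
chains that coincide along their first `d` edges have the same labels on these edges. Equivalently,
the label depends only on the part `r` of the chain (from `⊥`, omitted, to `x`) and on the upper
end `y` of the covering `x ⋖ y`: it is `lab r y`. -/
def labelSequence {P Λ : Type*} (lab : List P → P → Λ) : List P → List P → List Λ
  | _, [] => []
  | r, y :: c => lab r y :: labelSequence lab (r ++ [y]) c

/-- A chain-edge labelling is a CL-labelling if for each interval `[x, y]` rooted at a maximal
chain `r` of `[⊥, x]` there is a unique maximal chain `a` whose labels increase, and the labels of
`a` precede lexicographically those of every other maximal chain of `[x, y]`. -/
def IsCLLabelling {P Λ : Type*} [PartialOrder P] [OrderBot P] [PartialOrder Λ]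
    (lab : List P → P → Λ) : Prop :=
  ∀ (r : List P) (x y : P), IsMaximalChainBetween ⊥ x r → x ≤ y →
    ∃ a : List P, IsMaximalChainBetween x y a ∧
      List.IsChain (· ≤ ·) (labelSequence lab r a) ∧
      ∀ b : List P, IsMaximalChainBetween x y b → b ≠ a →
        ¬ List.IsChain (· ≤ ·) (labelSequence lab r b) ∧
        List.Lex (· < ·) (labelSequence lab r a) (labelSequence lab r b)

/-- A finite bounded poset is CL-shellable if it is pure and admits a CL-labelling with labels in
some poset. -/
def IsCLShellable (P : Type*) [PartialOrder P] [BoundedOrder P] [Finite P] : Prop :=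
  IsPurePoset P ∧ ∃ (Λ : Type) (_ : PartialOrder Λ) (lab : List P → P → Λ), IsCLLabelling lab

/-! ### Homology of order complexes and Cohen–Macaulay posets -/

section Homology

variable (K : Type*) [CommRing K] (Q : Type*) [PartialOrder Q]

/-- The `K`-module of `(m - 1)`-chains of the order complex of `Q`, augmented in degree `-1`: a
basis is given by the chains `c₀ < ⋯ < c_{m-1}` in `Q`, and by the empty chain for `m = 0`. -/
def OrderComplexChains (m : ℕ) : Type _ := (Fin m ↪o Q) →₀ K

noncomputable instance (m : ℕ) : AddCommGroup (OrderComplexChains K Q m) :=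
  inferInstanceAs (AddCommGroup ((Fin m ↪o Q) →₀ K))

noncomputable instance (m : ℕ) : Module K (OrderComplexChains K Q m) :=
  inferInstanceAs (Module K ((Fin m ↪o Q) →₀ K))

/-- The basis element of a chain. -/
noncomputable def OrderComplexChains.of {m : ℕ} (c : Fin m ↪o Q) : OrderComplexChains K Q m :=
  Finsupp.single c 1

/-- The boundary `c ↦ ∑ (-1)^i (c without c_i)` on the chains with `m + 1` elements. -/
noncomputable def orderComplexBoundary (m : ℕ) :
    OrderComplexChains K Q (m + 1) →ₗ[K] OrderComplexChains K Q m :=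
  Finsupp.linearCombination K fun c : Fin (m + 1) ↪o Q =>
    ∑ i : Fin (m + 1), (-1 : K) ^ (i : ℕ) •
      OrderComplexChains.of K Q ((Fin.succAboveOrderEmb i).trans c)

/-- The `(m - 1)`-cycles; everything is a cycle in degree `-1`. -/
noncomputable def orderComplexCycles : (m : ℕ) → Submodule K (OrderComplexChains K Q m)
  | 0 => ⊤
  | m + 1 => LinearMap.ker (orderComplexBoundary K Q m)

/-- The reduced homology of the order complex of `Q` in degree `m - 1`, with coefficients in `K`. -/
abbrev ReducedHomology (m : ℕ) : Type _ :=
  orderComplexCycles K Q m ⧸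
    (LinearMap.range (orderComplexBoundary K Q m)).submoduleOf (orderComplexCycles K Q m)

end Homology

/-- A finite bounded poset is Cohen–Macaulay over `K` if it is pure and, for each open interval
`(x, y)`, the reduced homology of the order complex of `(x, y)` vanishes in all degrees `m - 1`
below its dimension (that is, whenever `m` is at most the dimension). -/
def IsCohenMacaulayPoset (K : Type*) [CommRing K] (P : Type*) [PartialOrder P] [BoundedOrder P]
    [Finite P] : Prop :=
  IsPurePoset P ∧ ∀ x y : P, x < y → ∀ m : ℕ,
    (m : WithBot ℕ∞) ≤ Order.krullDim (Set.Ioo x y) →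
      Subsingleton (ReducedHomology K (Set.Ioo x y) m)

/-!
The posets of pointed partitions of type `B` are not totally semimodular: if `u` identifies `a` with
`b`, keeping `a` pointed, and `v` identifies `a` with `-b`, keeping `b` pointed, then the common
upper bounds of `u` and `v` have a zero block that contains `±a` and `±b`, but whose pointed element
is none of these, so that a third block is absorbed as well and there is no common cover. This is
the only obstruction, and it does not occur if `u` or `v` has a zero block, since then there is
another pointed element to keep. What holds is `IsSemimodularRelTo`, for the upper set `Z` of the
pointed partitions with a zero block: two covers `u, v ≤ y` of `x` have a common cover below `y` if
`u ∈ Z` or `y ∉ Z`, and for `x < y ∈ Z` there is a cover of `x` in `Z` below `y`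
(`PointedPartitionB.isSemimodularRelTo_hasZeroBlock`). This concerns intervals only, so it passes to
every interval `[⊥, M]`.

This property suffices. Two covers of `x` that have no common cover below `y` both have one with a
third cover of `x`, which lies in `Z`. Thus ordering the covers of every element so that those in
`Z` come first gives a recursive atom ordering: if `s ∈ Z` covers a cover `a ∉ Z` of `x`, then `s`
also covers an earlier cover of `x`, one in `Z`. The associated integer labelling is
`rootedLabel`, and `isCLLabelling_of_covBy` reduces the CL-property to pairs of consecutive edges.

For the Cohen–Macaulay property (`IsSemimodularRelTo.isAcyclicAt_aboveBelow`), the open interval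
`(x, y)` is built by adding the covers of `x` in such an order. Each cover `a` contributes the cone
`[a, y)`, which is attached along a set of the same kind in the shorter interval `(a, y)`, and the
Mayer–Vietoris sequence applies.

For pointed partitions, all covers of `x` identify two pointed elements of `x`
(`exists_covBy_glue`), and decrease the number of pairs of opposite nonzero blocks by one. So a
common cover of `u` and `v` is obtained by making in `u` the identification that `v` makes in `x`;
what has to be seen is that the new block can be given a pointed element that is admissible for `v`
and for `y`. If `u` and `v` have the same partition, another block must be absorbed instead, the one
whose pointed element is pointed in `y`.
-/

/-! ### Maximal chains in finite posets -/

section MaximalChains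

variable {P : Type*} [PartialOrder P]

theorem isMaximalChainBetween_nil {x y : P} : IsMaximalChainBetween x y [] ↔ x = y := by
  simp [IsMaximalChainBetween]

theorem isMaximalChainBetween_cons {x y u : P} {c : List P} :
    IsMaximalChainBetween x y (u :: c) ↔ x ⋖ u ∧ IsMaximalChainBetween u y c := by
  simp [IsMaximalChainBetween, and_assoc]

theorem IsMaximalChainBetween.le {x y : P} {c : List P} (h : IsMaximalChainBetween x y c) :
    x ≤ y := by
  induction c generalizing x with
  | nil => exact (isMaximalChainBetween_nil.1 h).le
  | cons u c ih =>
    rw [isMaximalChainBetween_cons] at h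
    exact h.1.le.trans (ih h.2)

theorem IsMaximalChainBetween.append {x y z : P} {c d : List P}
    (h : IsMaximalChainBetween x y c) (h' : IsMaximalChainBetween y z d) :
    IsMaximalChainBetween x z (c ++ d) := by
  induction c generalizing x with
  | nil =>
    obtain rfl := isMaximalChainBetween_nil.1 h
    exact h'
  | cons u c ih =>
    rw [isMaximalChainBetween_cons] at h
    exact isMaximalChainBetween_cons.2 ⟨h.1, ih h.2⟩

/-- A maximal chain of `[x, x]` has no edges. -/
theorem IsMaximalChainBetween.eq_nil {x : P} {c : List P} (h : IsMaximalChainBetween x x c) :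
    c = [] := by
  cases c with
  | nil => rfl
  | cons u c =>
    rw [isMaximalChainBetween_cons] at h
    exact absurd (h.1.lt.trans_le h.2.le) (lt_irrefl x)

/-- The last element of a rooted chain is the first of the reversed list. -/
theorem IsMaximalChainBetween.headD_reverse {x y : P} {r : List P}
    (h : IsMaximalChainBetween x y r) : r.reverse.headD x = y := by
  induction r generalizing x with
  | nil => simpa using isMaximalChainBetween_nil.1 h
  | cons u r ih =>
    rw [isMaximalChainBetween_cons] at h
    rw [← ih h.2]
    cases h' : r.reverse with
    | nil => simp [h']
    | cons => simp [h']

theorem IsMaximalChainBetween.of_append_singleton {x y u : P} {r : List P}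
    (h : IsMaximalChainBetween x y (r ++ [u])) :
    u = y ∧ ∃ z, IsMaximalChainBetween x z r ∧ z ⋖ u := by
  induction r generalizing x with
  | nil =>
    rw [List.nil_append, isMaximalChainBetween_cons, isMaximalChainBetween_nil] at h
    exact ⟨h.2, x, isMaximalChainBetween_nil.2 rfl, h.1⟩
  | cons v r ih =>
    rw [List.cons_append, isMaximalChainBetween_cons] at h
    obtain ⟨h₁, z, h₂, h₃⟩ := ih h.2
    exact ⟨h₁, z, isMaximalChainBetween_cons.2 ⟨h.1, h₂⟩, h₃⟩

variable [Finite P]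

theorem exists_isMaximalChainBetween {x y : P} (h : x ≤ y) :
    ∃ c, IsMaximalChainBetween x y c := by
  induction x using WellFoundedGT.induction with
  | ind x ih =>
    rcases h.eq_or_lt with rfl | h
    · exact ⟨[], isMaximalChainBetween_nil.2 rfl⟩
    · obtain ⟨u, hu, huy⟩ := exists_covBy_le_of_lt h
      obtain ⟨c, hc⟩ := ih u hu.lt huy
      exact ⟨u :: c, isMaximalChainBetween_cons.2 ⟨hu, hc⟩⟩

/-- Every chain can be refined to a maximal chain. -/
theorem exists_isMaximalChainBetween_length_le {x y : P} {l : List P}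
    (h : List.IsChain (· < ·) (x :: l)) (hy : (x :: l).getLast (List.cons_ne_nil x l) = y) :
    ∃ c, IsMaximalChainBetween x y c ∧ l.length ≤ c.length := by
  induction l generalizing x with
  | nil => exact ⟨[], isMaximalChainBetween_nil.2 (by simpa using hy), le_rfl⟩
  | cons z l ih =>
    rw [List.isChain_cons_cons] at h
    obtain ⟨c, hc, hl⟩ := ih h.2 (by simpa using hy)
    obtain ⟨d, hd⟩ := exists_isMaximalChainBetween h.1.le
    refine ⟨d ++ c, hd.append hc, ?_⟩
    cases d with
    | nil => exact absurd (isMaximalChainBetween_nil.1 hd) h.1.ne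
    | cons => simp; omega

end MaximalChains

/-! ### Semimodularity relative to an upper set -/

/-- A weakening of total semimodularity: two covers `u, v ≤ y` of `x` are required to have a common
cover below `y` only if `u` lies in a given upper set `Z`, or if `y` does not. In the first case
there need to be enough covers in `Z`. -/
structure IsSemimodularRelTo {P : Type*} [PartialOrder P] (Z : P → Prop) : Prop where
  mono : ∀ {x y}, x ≤ y → Z x → Z y
  exists_join : ∀ {x u v y}, x ⋖ u → x ⋖ v → u ≠ v → u ≤ y → v ≤ y → (Z u ∨ ¬ Z y) →
    ∃ w ≤ y, u ⋖ w ∧ v ⋖ w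
  exists_covBy : ∀ {x y}, x < y → Z y → ∃ g, x ⋖ g ∧ g ≤ y ∧ Z g

namespace IsSemimodularRelTo

variable {P : Type*} [PartialOrder P] {Z : P → Prop}

/-- Two covers of `x` below `y` without a common cover below `y` both have a common cover below `y`
with some cover `g ∈ Z` of `x`. -/
theorem exists_join_or (hZ : IsSemimodularRelTo Z) {x u v y : P} (hu : x ⋖ u) (hv : x ⋖ v)
    (huv : u ≠ v) (huy : u ≤ y) (hvy : v ≤ y) :
    (∃ w ≤ y, u ⋖ w ∧ v ⋖ w) ∨
      ¬ Z u ∧ ¬ Z v ∧ ∃ g, x ⋖ g ∧ g ≤ y ∧ Z g ∧ (∃ w ≤ y, g ⋖ w ∧ u ⋖ w) ∧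
        ∃ w ≤ y, g ⋖ w ∧ v ⋖ w := by
  by_cases h : Z u ∨ ¬ Z y
  · exact Or.inl (hZ.exists_join hu hv huv huy hvy h)
  by_cases h' : Z v
  · obtain ⟨w, hw, h₁, h₂⟩ := hZ.exists_join hv hu huv.symm hvy huy (Or.inl h')
    exact Or.inl ⟨w, hw, h₂, h₁⟩
  · push Not at h
    obtain ⟨g, hg, hgy, hZg⟩ := hZ.exists_covBy (hu.lt.trans_le huy) h.2
    refine Or.inr ⟨h.1, h', g, hg, hgy, hZg, ?_, ?_⟩
    · exact hZ.exists_join hg hu (by rintro rfl; exact h.1 hZg) hgy huy (Or.inl hZg)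
    · exact hZ.exists_join hg hv (by rintro rfl; exact h' hZg) hgy hvy (Or.inl hZg)

/-- If `s ∈ Z` covers a cover `a ∉ Z` of `x`, it also covers a cover of `x` that lies in `Z`. -/
theorem exists_covBy_covBy (hZ : IsSemimodularRelTo Z) {x a s : P} (ha : x ⋖ a) (hs : a ⋖ s)
    (haZ : ¬ Z a) (hsZ : Z s) : ∃ g, x ⋖ g ∧ g ⋖ s ∧ Z g := by
  obtain ⟨g, hg, hgs, hgZ⟩ := hZ.exists_covBy (ha.lt.trans hs.lt) hsZ
  obtain ⟨w, hws, hgw, haw⟩ := hZ.exists_join hg ha (by rintro rfl; exact haZ hgZ) hgs hs.le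
    (Or.inl hgZ)
  obtain rfl : w = s := hws.eq_of_not_lt fun h => hs.2 haw.lt h
  exact ⟨g, hg, hgw, hgZ⟩

theorem isPurePoset [Finite P] (hZ : IsSemimodularRelTo Z) : IsPurePoset P := by
  intro x y
  induction x using WellFoundedGT.induction with
  | ind x ih =>
    -- Maximal chains that start with covers having a common cover are compared through it.
    have key : ∀ {u v w : P} {c d : List P}, x ⋖ u → x ⋖ v → u ⋖ w → v ⋖ w → w ≤ y →
        IsMaximalChainBetween u y c → IsMaximalChainBetween v y d → c.length = d.length := by
      intro u v w c d hu hv huw hvw hw hc hd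
      obtain ⟨e, he⟩ := exists_isMaximalChainBetween hw
      rw [ih u hu.lt c (w :: e) hc (isMaximalChainBetween_cons.2 ⟨huw, he⟩),
        ih v hv.lt d (w :: e) hd (isMaximalChainBetween_cons.2 ⟨hvw, he⟩)]
    intro c d hc hd
    rcases c with _ | ⟨u, c⟩
    · obtain rfl := isMaximalChainBetween_nil.1 hc
      rw [hd.eq_nil]
    rcases d with _ | ⟨v, d⟩
    · obtain rfl := isMaximalChainBetween_nil.1 hd
      rw [hc.eq_nil]
    rw [isMaximalChainBetween_cons] at hc hd
    rw [List.length_cons, List.length_cons, Nat.add_right_cancel_iff]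
    by_cases huv : u = v
    · subst huv
      exact ih u hc.1.lt c d hc.2 hd.2
    rcases hZ.exists_join_or hc.1 hd.1 huv hc.2.le hd.2.le with
      ⟨w, hw, h₁, h₂⟩ | ⟨-, -, g, hg, hgy, -, ⟨w, hw, h₁, h₂⟩, w', hw', h₁', h₂'⟩
    · exact key hc.1 hd.1 h₁ h₂ hw hc.2 hd.2
    · obtain ⟨e, he⟩ := exists_isMaximalChainBetween hgy
      exact (key hg hc.1 h₁ h₂ hw he hc.2).symm.trans (key hg hd.1 h₁' h₂' hw' he hd.2)

theorem iic (hZ : IsSemimodularRelTo Z) (M : P) :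
    IsSemimodularRelTo (fun x : Set.Iic M => Z x) := by
  have hcov : ∀ {a b : Set.Iic M}, (a : P) ⋖ b ↔ a ⋖ b := fun {a b} =>
    Set.OrdConnected.apply_covBy_apply_iff (OrderEmbedding.subtype (· ∈ Set.Iic M))
      (by rw [OrderEmbedding.coe_subtype, Subtype.range_coe]; exact Set.ordConnected_Iic)
  refine ⟨fun h => hZ.mono h, ?_, ?_⟩
  · intro x u v y hu hv huv huy hvy h
    obtain ⟨w, hw, h₁, h₂⟩ := hZ.exists_join (hcov.2 hu) (hcov.2 hv)
      (fun h => huv (Subtype.ext h)) huy hvy h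
    exact ⟨⟨w, le_trans hw y.2⟩, hw, hcov.1 h₁, hcov.1 h₂⟩
  · intro x y hxy h
    obtain ⟨g, hg, hgy, hgZ⟩ := hZ.exists_covBy hxy h
    exact ⟨⟨g, le_trans hgy y.2⟩, hcov.1 hg, hgy, hgZ⟩

end IsSemimodularRelTo

/-! ### CL-labellings -/

section Labelling

variable {P : Type*} [PartialOrder P] [OrderBot P]

/-- A criterion for CL-labellings that involves only two consecutive edges `x ⋖ u ⋖ v`. They may
have a descent only if `v` covers a cover of `x` with a label smaller than that of `u`; and if there
is a cover of `x` below `y` with a label smaller than that of `u ≤ y`, then there must be a descent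
`x ⋖ u ⋖ v` with `v ≤ y`. -/
theorem isCLLabelling_of_covBy [Finite P] {Λ : Type*} [LinearOrder Λ] (lab : List P → P → Λ)
    (inj : ∀ {r x u u'}, IsMaximalChainBetween ⊥ x r → x ⋖ u → x ⋖ u' →
      lab r u = lab r u' → u = u')
    (desc : ∀ {r x u v}, IsMaximalChainBetween ⊥ x r → x ⋖ u → u ⋖ v →
      lab (r ++ [u]) v < lab r u → ∃ u', x ⋖ u' ∧ u' ⋖ v ∧ lab r u' < lab r u)
    (asc : ∀ {r x u u' y}, IsMaximalChainBetween ⊥ x r → x ⋖ u → x ⋖ u' → u ≤ y → u' ≤ y →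
      lab r u' < lab r u → ∃ v ≤ y, u ⋖ v ∧ lab (r ++ [u]) v < lab r u) :
    IsCLLabelling lab := by
  suffices H : ∀ (x : P) (r : List P) (y : P), IsMaximalChainBetween ⊥ x r → x ≤ y →
      ∃ a : List P, IsMaximalChainBetween x y a ∧
        List.IsChain (· ≤ ·) (labelSequence lab r a) ∧
        (∀ b : List P, IsMaximalChainBetween x y b → b ≠ a →
          ¬ List.IsChain (· ≤ ·) (labelSequence lab r b) ∧
          List.Lex (· < ·) (labelSequence lab r a) (labelSequence lab r b)) ∧
        ∀ u a', a = u :: a' → ∀ u', x ⋖ u' → u' ≤ y → lab r u ≤ lab r u' by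
    intro r x y hr hxy
    obtain ⟨a, h₁, h₂, h₃, -⟩ := H x r y hr hxy
    exact ⟨a, h₁, h₂, h₃⟩
  intro x
  induction x using WellFoundedGT.induction with
  | ind x ih =>
    intro r y hr hxy
    rcases hxy.eq_or_lt with rfl | hxy
    · refine ⟨[], isMaximalChainBetween_nil.2 rfl, by simp [labelSequence], ?_, by simp⟩
      exact fun b hb hb' => absurd hb.eq_nil hb'
    have hroot : ∀ {u}, x ⋖ u → IsMaximalChainBetween ⊥ u (r ++ [u]) := fun hu =>
      hr.append (isMaximalChainBetween_cons.2 ⟨hu, isMaximalChainBetween_nil.2 rfl⟩)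
    obtain ⟨u, ⟨hu, huy⟩, hmin⟩ := Set.exists_min_image {u | x ⋖ u ∧ u ≤ y} (lab r)
      (Set.toFinite _) (exists_covBy_le_of_lt hxy)
    obtain ⟨a, ha, hinc, hlex, -⟩ := ih u hu.lt (r ++ [u]) y (hroot hu) huy
    refine ⟨u :: a, isMaximalChainBetween_cons.2 ⟨hu, ha⟩, ?_, ?_, ?_⟩
    · rcases a with _ | ⟨v, a⟩
      · simp [labelSequence]
      · refine List.isChain_cons_cons.2 ⟨?_, hinc⟩
        rw [isMaximalChainBetween_cons] at ha
        by_contra! hlt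
        obtain ⟨u', hu', hu'v, hlt'⟩ := desc hr hu ha.1 hlt
        exact (hmin u' ⟨hu', hu'v.le.trans ha.2.le⟩).not_gt hlt'
    · rintro (_ | ⟨u', b⟩) hb hne
      · exact absurd (isMaximalChainBetween_nil.1 hb) hxy.ne
      rw [isMaximalChainBetween_cons] at hb
      by_cases huu : u' = u
      · subst huu
        obtain ⟨h₁, h₂⟩ := hlex b hb.2 (by simpa using hne)
        exact ⟨fun h => h₁ h.tail, List.Lex.cons h₂⟩
      have hlt : lab r u < lab r u' := (hmin u' ⟨hb.1, hb.2.le⟩).lt_of_ne fun h =>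
        huu (inj hr hu hb.1 h).symm
      refine ⟨fun hinc' => ?_, List.Lex.rel hlt⟩
      -- An increasing chain through `u'` would continue with the least label above `u'`.
      obtain ⟨v, hvy, huv, hv⟩ := asc hr hb.1 hu hb.2.le huy hlt
      obtain ⟨a', -, -, hlex', hmin'⟩ := ih u' hb.1.lt (r ++ [u']) y (hroot hb.1) hb.2.le
      obtain rfl : b = a' := by
        by_contra hne'
        exact (hlex' b hb.2 hne').1 hinc'.tail
      rcases b with _ | ⟨v₀, b⟩
      · obtain rfl := isMaximalChainBetween_nil.1 hb.2
        exact huv.lt.not_ge hvy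
      · have h₁ : lab r u' ≤ lab (r ++ [u']) v₀ := (List.isChain_cons_cons.1 hinc').1
        exact (h₁.trans (hmin' v₀ b rfl v huv hvy)).not_gt hv
    · rintro _ _ h u' hu' hu'y
      obtain ⟨rfl, -⟩ := List.cons_eq_cons.1 h
      exact hmin u' ⟨hu', hu'y⟩

open Classical in
/-- The label of a covering, as a function of the upper end `u` and of the root chain, listed in
decreasing order. Let `e` enumerate the elements by numbers below `N`. The label of a covering
`x ⋖ u` is smaller than that of the last edge of the root, which ends at `x`, precisely if `u` also
covers an element that precedes `x` among the covers of the preceding element of the root; given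
this, covers in `Z` come first, and then the order is that of `e`. -/
noncomputable def rootedLabel (Z : P → Prop) (e : P → ℕ) (N : ℕ) : List P → P → ℤ
  | [], u => e u + if Z u then 0 else N
  | x :: r, u => rootedLabel Z e N r x + e u + (if Z u then 0 else N) -
      if ∃ u', r.headD ⊥ ⋖ u' ∧ u' ⋖ u ∧ rootedLabel Z e N r u' < rootedLabel Z e N r x
      then 2 * N else 0

variable {Z : P → Prop} {e : P → ℕ} {N : ℕ}

theorem rootedLabel_lt_iff (he : ∀ u, e u < N) {r : List P} {x u : P} :
    rootedLabel Z e N (x :: r) u < rootedLabel Z e N r x ↔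
      ∃ u', r.headD ⊥ ⋖ u' ∧ u' ⋖ u ∧ rootedLabel Z e N r u' < rootedLabel Z e N r x := by
  have := he u
  rw [rootedLabel]
  split_ifs with h₁ h₂ h₂ <;> simp only [h₂, iff_true, iff_false] <;> omega

theorem rootedLabel_injective (he : ∀ u, e u < N) (hinj : Function.Injective e) (r : List P) :
    Function.Injective (rootedLabel Z e N r) := by
  intro u u' h
  have h₁ := he u
  have h₂ := he u'
  refine hinj ?_
  rcases r with _ | ⟨x, r⟩ <;> rw [rootedLabel, rootedLabel] at h <;> split_ifs at h <;> omega

/-- Covers in `Z` have smaller labels than the other ones. -/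
theorem IsSemimodularRelTo.rootedLabel_lt (hZ : IsSemimodularRelTo Z) (he : ∀ u, e u < N)
    {r : List P} {x g u : P} (hr : IsMaximalChainBetween ⊥ x r) (hg : x ⋖ g) (hu : x ⋖ u)
    (hgZ : Z g) (huZ : ¬ Z u) :
    rootedLabel Z e N r.reverse g < rootedLabel Z e N r.reverse u := by
  have hge := he g
  induction r using List.reverseRecOn generalizing x g u with
  | nil => simp only [List.reverse_nil, rootedLabel, hgZ, huZ, if_true, if_false]; omega
  | append_singleton r a ih =>
    obtain ⟨rfl, z, hz, hza⟩ := hr.of_append_singleton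
    have haZ : ¬ Z a := fun h => huZ (hZ.mono hu.le h)
    obtain ⟨g', hg', hg'g, hg'Z⟩ := hZ.exists_covBy_covBy hza hg haZ hgZ
    have hlt := ih hz hg' hza hg'Z haZ (he g')
    rw [List.reverse_append, List.reverse_singleton, List.singleton_append, rootedLabel,
      rootedLabel, if_pos hgZ, if_neg huZ, if_pos ⟨g', by rwa [hz.headD_reverse], hg'g, hlt⟩]
    split_ifs <;> omega

theorem IsSemimodularRelTo.isCLLabelling [Finite P] (hZ : IsSemimodularRelTo Z) (he : ∀ u, e u < N)
    (hinj : Function.Injective e) :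
    IsCLLabelling fun r u => rootedLabel Z e N r.reverse u := by
  have hrev : ∀ {r : List P} {u v x : P}, IsMaximalChainBetween ⊥ x r →
      (rootedLabel Z e N (r ++ [u]).reverse v < rootedLabel Z e N r.reverse u ↔
        ∃ u', x ⋖ u' ∧ u' ⋖ v ∧
          rootedLabel Z e N r.reverse u' < rootedLabel Z e N r.reverse u) := by
    intro r u v x hr
    rw [List.reverse_append, List.reverse_singleton, List.singleton_append, rootedLabel_lt_iff he,
      hr.headD_reverse]
  refine isCLLabelling_of_covBy _ (fun _ _ _ h => rootedLabel_injective he hinj _ h)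
    (fun hr _ _ h => (hrev hr).1 h) ?_
  intro r x u u' y hr hu hu' huy hu'y hlt
  simp only [hrev hr]
  rcases hZ.exists_join_or hu hu' (by rintro rfl; exact hlt.false) huy hu'y with
    ⟨w, hw, h₁, h₂⟩ | ⟨h, -, g, hg, hgy, hgZ, ⟨w, hw, h₁, h₂⟩, -⟩
  · exact ⟨w, hw, h₁, u', hu', h₂, hlt⟩
  · exact ⟨w, hw, h₂, g, hg, h₁, hZ.rootedLabel_lt he hr hg hu hgZ h⟩

end Labelling

theorem IsSemimodularRelTo.isCLShellable {P : Type*} [PartialOrder P] [BoundedOrder P] [Finite P]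
    {Z : P → Prop} (hZ : IsSemimodularRelTo Z) : IsCLShellable P := by
  obtain ⟨N, ⟨f⟩⟩ := Finite.exists_equiv_fin P
  exact ⟨hZ.isPurePoset, ℤ, inferInstance, _, hZ.isCLLabelling (e := fun u => f u) (N := N)
    (fun u => (f u).2) (Fin.val_injective.comp f.injective)⟩

/-! ### Chains of order complexes -/

section OrderComplex

variable (K : Type*) [CommRing K] {P : Type*} [PartialOrder P]

/-- The boundary of `orderComplexBoundary`, on modules of finitely supported functions. -/
noncomputable def chainBoundary (m : ℕ) : ((Fin (m + 1) ↪o P) →₀ K) →ₗ[K] ((Fin m ↪o P) →₀ K) :=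
  Finsupp.linearCombination K fun c : Fin (m + 1) ↪o P =>
    ∑ i : Fin (m + 1), (-1 : K) ^ (i : ℕ) •
      Finsupp.single ((Fin.succAboveOrderEmb i).trans c) (1 : K)

/-- The cycles of the augmented complex; every chain of degree `-1` is a cycle. -/
def IsChainCycle : {m : ℕ} → ((Fin m ↪o P) →₀ K) → Prop
  | 0, _ => True
  | m + 1, z => chainBoundary K m z = 0

/-- The linear combinations of chains `Fin m ↪o P` with all elements in `U`. -/
def chainsIn (U : Set P) (m : ℕ) : Submodule K ((Fin m ↪o P) →₀ K) :=
  Finsupp.supported K K {c | ∀ i, c i ∈ U}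

/-- The order complex of `U` has vanishing reduced homology in degree `m - 1`. -/
def IsAcyclicAt (U : Set P) (m : ℕ) : Prop :=
  ∀ z ∈ chainsIn K U m, IsChainCycle K z → ∃ w ∈ chainsIn K U (m + 1), chainBoundary K m w = z

variable {K}

theorem chainBoundary_single {m : ℕ} (c : Fin (m + 1) ↪o P) (k : K) :
    chainBoundary K m (Finsupp.single c k) = k • ∑ i : Fin (m + 1), (-1 : K) ^ (i : ℕ) •
      Finsupp.single ((Fin.succAboveOrderEmb i).trans c) (1 : K) := by
  rw [chainBoundary, Finsupp.linearCombination_single]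

theorem single_mem_chainsIn {U : Set P} {m : ℕ} {c : Fin m ↪o P} (hc : ∀ i, c i ∈ U) (k : K) :
    Finsupp.single c k ∈ chainsIn K U m :=
  Finsupp.single_mem_supported K k hc

theorem chainsIn_mono {U V : Set P} (h : U ⊆ V) (m : ℕ) : chainsIn K U m ≤ chainsIn K V m :=
  Finsupp.supported_mono fun _ hc i => h (hc i)

/-- Linear statements about chains in `U` need to be checked only on basis elements. -/
theorem chainsIn_induction {U : Set P} {m : ℕ} {p : ((Fin m ↪o P) →₀ K) → Prop}
    (zero : p 0) (add : ∀ z w, p z → p w → p (z + w)) (smul : ∀ (k : K) z, p z → p (k • z))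
    (single : ∀ c : Fin m ↪o P, (∀ i, c i ∈ U) → p (Finsupp.single c 1)) {z : (Fin m ↪o P) →₀ K}
    (hz : z ∈ chainsIn K U m) : p z := by
  rw [chainsIn, Finsupp.supported_eq_span_single] at hz
  induction hz using Submodule.span_induction with
  | mem z hz =>
    obtain ⟨c, hc, rfl⟩ := hz
    exact single c hc
  | zero => exact zero
  | add z w _ _ hz hw => exact add z w hz hw
  | smul k z _ hz => exact smul k z hz

theorem chainBoundary_mem {U : Set P} {m : ℕ} {z : (Fin (m + 1) ↪o P) →₀ K}
    (hz : z ∈ chainsIn K U (m + 1)) : chainBoundary K m z ∈ chainsIn K U m := by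
  refine chainsIn_induction (p := fun z => chainBoundary K m z ∈ chainsIn K U m) (by simp) ?_ ?_ ?_
    hz
  · intro z w hz hw
    rw [map_add]
    exact add_mem hz hw
  · intro k z hz
    rw [map_smul]
    exact Submodule.smul_mem _ _ hz
  · intro c hc
    rw [chainBoundary_single]
    refine Submodule.smul_mem _ _ (sum_mem fun i _ => Submodule.smul_mem _ _ ?_)
    exact single_mem_chainsIn (c := (Fin.succAboveOrderEmb i).trans c) (fun j => hc _) 1

theorem mem_chainsIn_inter {U V : Set P} {m : ℕ} {z : (Fin m ↪o P) →₀ K}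
    (hU : z ∈ chainsIn K U m) (hV : z ∈ chainsIn K V m) : z ∈ chainsIn K (U ∩ V) m := by
  intro c hc i
  exact ⟨hU hc i, hV hc i⟩

/-- The chain `a < c₀ < ⋯`. -/
def consChain {m : ℕ} (a : P) (c : Fin m ↪o P) (h : ∀ i, a < c i) : Fin (m + 1) ↪o P :=
  OrderEmbedding.ofStrictMono (Fin.cons a c) (Fin.strictMono_cons.2 ⟨h, c.strictMono⟩)

open Classical in
/-- The cone operator with apex `a`: it prepends `a` to the chains with all elements above `a`, and
maps the other ones to `0`. -/
noncomputable def coneMap (K : Type*) [CommRing K] (a : P) (m : ℕ) :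
    ((Fin m ↪o P) →₀ K) →ₗ[K] ((Fin (m + 1) ↪o P) →₀ K) :=
  Finsupp.linearCombination K fun c : Fin m ↪o P =>
    if h : ∀ i, a < c i then Finsupp.single (consChain a c h) 1 else 0

theorem coneMap_single {a : P} {m : ℕ} {c : Fin m ↪o P} (h : ∀ i, a < c i) :
    coneMap K a m (Finsupp.single c 1) = Finsupp.single (consChain a c h) 1 := by
  rw [coneMap, Finsupp.linearCombination_single, dif_pos h, one_smul]

theorem coneMap_consChain {a : P} {m : ℕ} {c : Fin m ↪o P} (h : ∀ i, a < c i) :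
    coneMap K a (m + 1) (Finsupp.single (consChain a c h) 1) = 0 := by
  rw [coneMap, Finsupp.linearCombination_single, dif_neg, smul_zero]
  exact fun h' => (h' 0).false

/-- A chain with all elements above or equal to `a` either has all elements above `a` or starts
with `a`. -/
theorem forall_lt_or_eq_consChain {a : P} {m : ℕ} {c : Fin (m + 1) ↪o P} (hc : ∀ i, a ≤ c i) :
    (∀ i, a < c i) ∨ ∃ (c' : Fin m ↪o P) (h : ∀ i, a < c' i), c = consChain a c' h := by
  rcases (hc 0).eq_or_lt with h | h
  · have h' : ∀ i : Fin m, a < c i.succ := fun i => h ▸ c.strictMono (Fin.succ_pos i)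
    refine Or.inr ⟨(Fin.succOrderEmb m).trans c, h', ?_⟩
    ext i
    refine Fin.cases h.symm (fun i => rfl) i
  · exact Or.inl fun i => h.trans_le (c.monotone (Fin.zero_le i))

theorem exists_eq_consChain {m : ℕ} (c : Fin (m + 1) ↪o P) :
    ∃ (a : P) (c' : Fin m ↪o P) (h : ∀ i, a < c' i), c = consChain a c' h := by
  refine ⟨c 0, (forall_lt_or_eq_consChain fun i => c.monotone (Fin.zero_le i)).resolve_left ?_⟩
  exact fun h => (h 0).false

theorem face_zero_consChain {a : P} {m : ℕ} {c : Fin m ↪o P} (h : ∀ i, a < c i) :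
    (Fin.succAboveOrderEmb 0).trans (consChain a c h) = c := by
  ext i
  simp [consChain]

theorem face_succ_consChain {a : P} {m : ℕ} {c : Fin (m + 1) ↪o P} (h : ∀ i, a < c i)
    (i : Fin (m + 1)) (h' : ∀ j, a < ((Fin.succAboveOrderEmb i).trans c) j) :
    (Fin.succAboveOrderEmb i.succ).trans (consChain a c h) =
      consChain a ((Fin.succAboveOrderEmb i).trans c) h' := by
  ext j
  refine Fin.cases ?_ (fun j => ?_) j
  · simp [consChain]
  · simp [consChain]

theorem chainBoundary_coneMap_zero (a : P) (z : (Fin 0 ↪o P) →₀ K) :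
    chainBoundary K 0 (coneMap K a 0 z) = z := by
  induction z using Finsupp.induction_linear with
  | zero => simp
  | add z w hz hw => rw [map_add, map_add, hz, hw]
  | single c k =>
    rw [← mul_one k, ← smul_eq_mul, ← Finsupp.smul_single, map_smul, map_smul,
      coneMap_single fun i => i.elim0, chainBoundary_single]
    simp [face_zero_consChain]

/-- On chains above the apex, `∂h + h∂ = 1`. -/
theorem chainBoundary_coneMap {a : P} {m : ℕ} {z : (Fin (m + 1) ↪o P) →₀ K}
    (hz : z ∈ chainsIn K (Set.Ioi a) (m + 1)) :
    chainBoundary K (m + 1) (coneMap K a (m + 1) z) = z - coneMap K a m (chainBoundary K m z) := by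
  refine chainsIn_induction (p := fun z => chainBoundary K (m + 1) (coneMap K a (m + 1) z) =
    z - coneMap K a m (chainBoundary K m z)) (by simp) ?_ ?_ ?_ hz
  · intro z w hz hw
    simp only [map_add, hz, hw]
    abel
  · intro k z hz
    simp only [map_smul, hz, smul_sub]
  · intro c hc
    replace hc : ∀ i, a < c i := hc
    rw [coneMap_single hc, chainBoundary_single, chainBoundary_single, one_smul, one_smul,
      Fin.sum_univ_succ, map_sum, face_zero_consChain, sub_eq_add_neg, ← Finset.sum_neg_distrib]
    congr 1
    · simp
    · refine Finset.sum_congr rfl fun i _ => ?_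
      have hi : ∀ j, a < ((Fin.succAboveOrderEmb i).trans c) j := fun j => hc _
      rw [face_succ_consChain hc i hi, map_smul, coneMap_single hi, Fin.val_succ, pow_succ]
      simp

theorem chainBoundary_chainBoundary {m : ℕ} (z : (Fin (m + 2) ↪o P) →₀ K) :
    chainBoundary K m (chainBoundary K (m + 1) z) = 0 := by
  induction m with
  | zero =>
    induction z using Finsupp.induction_linear with
    | zero => simp
    | add z w hz hw => rw [map_add, map_add, hz, hw, add_zero]
    | single c k =>
      obtain ⟨a, c, h, rfl⟩ := exists_eq_consChain c
      rw [← mul_one k, ← smul_eq_mul, ← Finsupp.smul_single, map_smul, map_smul,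
        ← coneMap_single h, chainBoundary_coneMap (single_mem_chainsIn h 1), map_sub,
        chainBoundary_coneMap_zero, sub_self, smul_zero]
  | succ m ih =>
    induction z using Finsupp.induction_linear with
    | zero => simp
    | add z w hz hw => rw [map_add, map_add, hz, hw, add_zero]
    | single c k =>
      obtain ⟨a, c, h, rfl⟩ := exists_eq_consChain c
      rw [← mul_one k, ← smul_eq_mul, ← Finsupp.smul_single, map_smul, map_smul,
        ← coneMap_single h, chainBoundary_coneMap (single_mem_chainsIn h 1), map_sub,
        chainBoundary_coneMap (chainBoundary_mem (single_mem_chainsIn h 1)), ih, map_zero, sub_zero,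
        sub_self, smul_zero]

theorem isChainCycle_chainBoundary {m : ℕ} (z : (Fin (m + 1) ↪o P) →₀ K) :
    IsChainCycle K (chainBoundary K m z) := by
  cases m with
  | zero => trivial
  | succ m => exact chainBoundary_chainBoundary z

/-! ### Vanishing of homology -/

theorem isAcyclicAt_zero {U : Set P} (hU : U.Nonempty) : IsAcyclicAt K U 0 := by
  obtain ⟨a, ha⟩ := hU
  intro z _ _
  refine ⟨coneMap K a 0 z, ?_, chainBoundary_coneMap_zero a z⟩
  refine chainsIn_induction (U := U) (p := fun z => coneMap K a 0 z ∈ chainsIn K U 1) (by simp) ?_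
    ?_ ?_ (z := z) fun c _ i => i.elim0
  · intro z w hz hw
    rw [map_add]
    exact add_mem hz hw
  · intro k z hz
    rw [map_smul]
    exact Submodule.smul_mem _ _ hz
  · intro c _
    rw [coneMap_single fun i => i.elim0]
    refine single_mem_chainsIn (fun i => ?_) 1
    refine Fin.cases ha (fun i => i.elim0) i

/-- The order complex of a set with a least element is a cone. -/
theorem isAcyclicAt_of_isLeast {U : Set P} {a : P} (ha : IsLeast U a) (m : ℕ) :
    IsAcyclicAt K U m := by
  cases m with
  | zero => exact isAcyclicAt_zero ⟨a, ha.1⟩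
  | succ m =>
    intro z hz hz₀
    suffices H : coneMap K a (m + 1) z ∈ chainsIn K U (m + 2) ∧
        chainBoundary K (m + 1) (coneMap K a (m + 1) z) =
          z - coneMap K a m (chainBoundary K m z) by
      refine ⟨_, H.1, ?_⟩
      have h₀ : chainBoundary K m z = 0 := hz₀
      rw [H.2, h₀, map_zero, sub_zero]
    refine chainsIn_induction (p := fun z => coneMap K a (m + 1) z ∈ chainsIn K U (m + 2) ∧
      chainBoundary K (m + 1) (coneMap K a (m + 1) z) =
        z - coneMap K a m (chainBoundary K m z)) (by simp) ?_ ?_ ?_ hz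
    · intro z w hz hw
      simp only [map_add, hz.2, hw.2]
      exact ⟨add_mem hz.1 hw.1, by abel⟩
    · intro k z hz
      simp only [map_smul, hz.2, smul_sub, and_true]
      exact Submodule.smul_mem _ _ hz.1
    · intro c hc
      obtain h | ⟨c, h, rfl⟩ := forall_lt_or_eq_consChain fun i => ha.2 (hc i)
      · refine ⟨?_, chainBoundary_coneMap (single_mem_chainsIn h 1)⟩
        rw [coneMap_single h]
        exact single_mem_chainsIn (fun i => Fin.cases ha.1 hc i) 1
      · rw [coneMap_consChain, map_zero]
        refine ⟨zero_mem _, ?_⟩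
        cases m with
        | zero => rw [← coneMap_single h, chainBoundary_coneMap_zero, sub_self]
        | succ m =>
          have hh : coneMap K a (m + 1) (coneMap K a m
              (chainBoundary K m (Finsupp.single c 1))) = 0 := by
            refine chainsIn_induction (p := fun z => coneMap K a (m + 1) (coneMap K a m z) = 0)
              (by simp) ?_ ?_ ?_ (chainBoundary_mem (U := Set.Ioi a) (single_mem_chainsIn h 1))
            · intro z w hz hw
              rw [map_add, map_add, hz, hw, add_zero]
            · intro k z hz
              rw [map_smul, map_smul, hz, smul_zero]
            · intro c hc
              replace hc : ∀ i, a < c i := hc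
              rw [coneMap_single hc, coneMap_consChain]
          rw [← coneMap_single h, chainBoundary_coneMap (single_mem_chainsIn h 1), map_sub, hh,
            sub_zero, sub_self]

/-- A part of the Mayer–Vietoris sequence. -/
theorem IsAcyclicAt.union {U V : Set P} {m : ℕ} (hU : IsAcyclicAt K U (m + 1))
    (hV : IsAcyclicAt K V (m + 1)) (hUV : IsAcyclicAt K (U ∩ V) m)
    (h : ∀ c : Fin (m + 1) ↪o P, (∀ i, c i ∈ U ∪ V) → (∀ i, c i ∈ U) ∨ ∀ i, c i ∈ V) :
    IsAcyclicAt K (U ∪ V) (m + 1) := by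
  intro z hz hz₀
  have hz₀ : chainBoundary K m z = 0 := hz₀
  obtain ⟨z₁, hz₁, z₂, hz₂, rfl⟩ : ∃ z₁ ∈ chainsIn K U (m + 1), ∃ z₂ ∈ chainsIn K V (m + 1),
      z₁ + z₂ = z := by
    rw [← Submodule.mem_sup, chainsIn, chainsIn, ← Finsupp.supported_union]
    exact Finsupp.supported_mono (fun c hc => h c hc) hz
  rw [map_add] at hz₀
  have hneg : chainBoundary K m z₁ = - chainBoundary K m z₂ := eq_neg_of_add_eq_zero_left hz₀
  obtain ⟨t, ht, ht'⟩ := hUV (chainBoundary K m z₁)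
    (mem_chainsIn_inter (chainBoundary_mem hz₁) (hneg ▸ neg_mem (chainBoundary_mem hz₂)))
    (isChainCycle_chainBoundary z₁)
  obtain ⟨w₁, hw₁, hw₁'⟩ := hU (z₁ - t)
    (sub_mem hz₁ (chainsIn_mono Set.inter_subset_left _ ht))
    (show chainBoundary K m (z₁ - t) = 0 by rw [map_sub, ht', sub_self])
  obtain ⟨w₂, hw₂, hw₂'⟩ := hV (z₂ + t)
    (add_mem hz₂ (chainsIn_mono Set.inter_subset_right _ ht))
    (show chainBoundary K m (z₂ + t) = 0 by rw [map_add, ht', add_comm, hz₀])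
  refine ⟨w₁ + w₂, add_mem (chainsIn_mono Set.subset_union_left _ hw₁)
    (chainsIn_mono Set.subset_union_right _ hw₂), ?_⟩
  rw [map_add, hw₁', hw₂']
  abel

end OrderComplex

/-! ### The Cohen–Macaulay property -/

section CohenMacaulay

variable {P : Type*} [PartialOrder P]

/-- The elements below `y` that lie above some element of `S`. -/
def aboveBelow (S : Set P) (y : P) : Set P :=
  {v | v < y ∧ ∃ s ∈ S, s ≤ v}

/-- If `S` is a nonempty set of covers of `x` below `y` that contains all or none of those outside
`Z` as soon as it contains one of them, then the elements of `[x, y)` above `S` have no homology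
below the top degree. The covers are added one at a time, those in `Z` first: the elements above a
new cover `a` form a cone, which meets the previous set in the elements of `[a, y)` above certain
covers of `a`, to which the induction hypothesis applies. -/
theorem IsSemimodularRelTo.isAcyclicAt_aboveBelow [Finite P] {Z : P → Prop}
    (hZ : IsSemimodularRelTo Z) (K : Type*) [CommRing K] {m : ℕ} {x y : P} {S : Set P}
    (hS : ∀ s ∈ S, x ⋖ s ∧ s ≤ y) (hne : S.Nonempty)
    (hSZ : (∀ s ∈ S, Z s) ∨ ∀ g, x ⋖ g → g ≤ y → Z g → g ∈ S)
    (hlen : ∀ c, IsMaximalChainBetween x y c → m + 2 ≤ c.length) :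
    IsAcyclicAt K (aboveBelow S y) m := by
  induction m generalizing x S with
  | zero =>
    obtain ⟨s, hs⟩ := hne
    refine isAcyclicAt_zero ⟨s, (hS s hs).2.lt_of_ne ?_, s, hs, le_rfl⟩
    rintro rfl
    have := hlen [s] (isMaximalChainBetween_cons.2 ⟨(hS s hs).1, isMaximalChainBetween_nil.2 rfl⟩)
    simp at this
  | succ m ihm =>
    have hlt : ∀ {s}, x ⋖ s → s ≤ y → s < y := by
      intro s hs hsy
      refine hsy.lt_of_ne ?_
      rintro rfl
      have := hlen [s] (isMaximalChainBetween_cons.2 ⟨hs, isMaximalChainBetween_nil.2 rfl⟩)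
      simp at this
    induction S using WellFoundedLT.induction with
    | ind S ihS =>
      -- The last cover `a` is chosen outside `Z` if possible.
      obtain ⟨a, ha, haZ⟩ : ∃ a ∈ S, Z a → ∀ s ∈ S, Z s := by
        by_cases h : ∃ a ∈ S, ¬ Z a
        · obtain ⟨a, ha, haZ⟩ := h
          exact ⟨a, ha, fun h => absurd h haZ⟩
        · push Not at h
          obtain ⟨a, ha⟩ := hne
          exact ⟨a, ha, fun _ => h⟩
      have hcone : ∀ k, IsAcyclicAt K (aboveBelow {a} y) k :=
        isAcyclicAt_of_isLeast ⟨⟨hlt (hS a ha).1 (hS a ha).2, a, rfl, le_rfl⟩, by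
          rintro v ⟨-, s, rfl, hs⟩
          exact hs⟩
      have hunion : aboveBelow S y = aboveBelow (S \ {a}) y ∪ aboveBelow {a} y := by
        ext v
        constructor
        · rintro ⟨hv, s, hs, hsv⟩
          by_cases h : s = a
          · exact Or.inr ⟨hv, s, h, hsv⟩
          · exact Or.inl ⟨hv, s, ⟨hs, h⟩, hsv⟩
        · rintro (⟨hv, s, hs, hsv⟩ | ⟨hv, s, rfl, hsv⟩)
          · exact ⟨hv, s, hs.1, hsv⟩
          · exact ⟨hv, s, ha, hsv⟩
      rw [hunion]
      rcases (S \ {a}).eq_empty_or_nonempty with he | hne'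
      · rw [he]
        convert! hcone (m + 1)
        ext v
        simp [aboveBelow]
      have hSZ' : (∀ s ∈ S \ {a}, Z s) ∨ ∀ g, x ⋖ g → g ≤ y → Z g → g ∈ S \ {a} := by
        by_cases h : Z a
        · exact Or.inl fun s hs => haZ h s hs.1
        · refine Or.inr fun g hg hgy hgZ =>
            ⟨hSZ.resolve_left (fun h' => h (h' a ha)) g hg hgy hgZ, ?_⟩
          rintro rfl
          exact h hgZ
      -- Every other element of `S` is joined to `a` through a cover of `a`.
      have hjoin : ∀ {b v}, b ∈ S \ {a} → b ≤ v → a ≤ v → v ≤ y →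
          ∃ s ≤ v, a ⋖ s ∧ ∃ b' ∈ S \ {a}, b' ⋖ s := by
        intro b v hb hbv hav hvy
        rcases hZ.exists_join_or (hS a ha).1 (hS b hb.1).1 (fun h => hb.2 h.symm) hav hbv with
          ⟨w, hw, h₁, h₂⟩ | ⟨h, -, g, hg, hgv, hgZ, ⟨w, hw, h₁, h₂⟩, -⟩
        · exact ⟨w, hw, h₁, b, hb, h₂⟩
        · refine ⟨w, hw, h₂, g, ⟨?_, ?_⟩, h₁⟩
          · exact hSZ.resolve_left (fun h' => h (h' a ha)) g hg (hgv.trans hvy) hgZ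
          · rintro rfl
            exact h hgZ
      let S' : Set P := {s | a ⋖ s ∧ s ≤ y ∧ ∃ b ∈ S \ {a}, b ⋖ s}
      have hinter : aboveBelow (S \ {a}) y ∩ aboveBelow {a} y = aboveBelow S' y := by
        ext v
        constructor
        · rintro ⟨⟨hv, b, hb, hbv⟩, -, _, rfl, hav⟩
          obtain ⟨s, hsv, has, h⟩ := hjoin hb hbv hav hv.le
          exact ⟨hv, s, ⟨has, hsv.trans hv.le, h⟩, hsv⟩
        · rintro ⟨hv, s, ⟨has, -, b, hb, hbs⟩, hsv⟩
          exact ⟨⟨hv, b, hb, hbs.le.trans hsv⟩, hv, a, rfl, has.le.trans hsv⟩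
      refine IsAcyclicAt.union ?_ (hcone _) ?_ ?_
      · exact ihS _ (Set.sdiff_singleton_ssubset.2 ha) (fun s hs => hS s hs.1) hne' hSZ'
      · rw [hinter]
        refine ihm (x := a) (fun s hs => ⟨hs.1, hs.2.1⟩) ?_ ?_ ?_
        · obtain ⟨b, hb⟩ := hne'
          obtain ⟨s, hsy, has, h⟩ := hjoin hb (hS b hb.1).2 (hS a ha).2 le_rfl
          exact ⟨s, has, hsy, h⟩
        · by_cases h : Z a
          · exact Or.inl fun s hs => hZ.mono hs.1.le h
          · refine Or.inr fun s hs hsy hsZ => ⟨hs, hsy, ?_⟩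
            obtain ⟨g, hg, hgs, hgZ⟩ := hZ.exists_covBy_covBy (hS a ha).1 hs h hsZ
            refine ⟨g, ⟨?_, ?_⟩, hgs⟩
            · exact hSZ.resolve_left (fun h' => h (h' a ha)) g hg (hgs.le.trans hsy) hgZ
            · rintro rfl
              exact h hgZ
        · intro c hc
          have := hlen (a :: c) (isMaximalChainBetween_cons.2 ⟨(hS a ha).1, hc⟩)
          rw [List.length_cons] at this
          omega
      · -- Both sets are upper sets in `{v | v < y}`, so the least element of a chain decides.
        intro c hc
        have hy : ∀ i, c i < y := fun i => (hc i).elim (fun h => h.1) (fun h => h.1)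
        rcases hc 0 with ⟨-, s, hs, hsc⟩ | ⟨-, s, hs, hsc⟩
        · exact Or.inl fun i => ⟨hy i, s, hs, hsc.trans (c.monotone (Fin.zero_le i))⟩
        · exact Or.inr fun i => ⟨hy i, s, hs, hsc.trans (c.monotone (Fin.zero_le i))⟩

/-- Reduced homology of a subset, computed with chains of the ambient poset. -/
theorem IsAcyclicAt.subsingleton_reducedHomology {K : Type*} [CommRing K] {U : Set P} {m : ℕ}
    (h : IsAcyclicAt K U m) : Subsingleton (ReducedHomology K U m) := by
  -- The inclusion `i` of chain groups is injective with image `chainsIn K U`.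
  let j : ∀ k, (Fin k ↪o U) → (Fin k ↪o P) := fun k c => c.trans (OrderEmbedding.subtype (· ∈ U))
  have hj : ∀ k, Function.Injective (j k) := by
    intro k c c' hcc
    ext t
    exact congrArg (fun f : Fin k ↪o P => f t) hcc
  let i : ∀ k, ((Fin k ↪o U) →₀ K) →ₗ[K] ((Fin k ↪o P) →₀ K) := fun k =>
    Finsupp.lmapDomain K K (j k)
  have hi : ∀ k, Function.Injective (i k) := fun k => Finsupp.mapDomain_injective (hj k)
  have hmem : ∀ k z, i k z ∈ chainsIn K U k := by
    intro k z
    induction z using Finsupp.induction_linear with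
    | zero => simp
    | add z w hz hw => rw [map_add]; exact add_mem hz hw
    | single c a =>
      rw [Finsupp.lmapDomain_apply, Finsupp.mapDomain_single]
      exact single_mem_chainsIn (fun t => (c t).2) a
  have hsurj : ∀ k, ∀ w ∈ chainsIn K U k, ∃ z, i k z = w := by
    intro k w hw
    refine chainsIn_induction (p := fun w => ∃ z, i k z = w) ⟨0, map_zero _⟩ ?_ ?_ ?_ hw
    · rintro _ _ ⟨z, rfl⟩ ⟨w, rfl⟩
      exact ⟨z + w, map_add _ _ _⟩
    · rintro a _ ⟨z, rfl⟩
      exact ⟨a • z, map_smul _ _ _⟩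
    · intro c hc
      let c' : Fin k ↪o U :=
        OrderEmbedding.ofStrictMono (fun t => ⟨c t, hc t⟩) fun _ _ h => c.strictMono h
      refine ⟨Finsupp.single c' 1, ?_⟩
      rw [Finsupp.lmapDomain_apply, Finsupp.mapDomain_single]
      rfl
  have hcomm : ∀ k z, i k (chainBoundary K k z) = chainBoundary K k (i (k + 1) z) := by
    intro k z
    induction z using Finsupp.induction_linear with
    | zero => simp
    | add z w hz hw => simp only [map_add, hz, hw]
    | single c a =>
      rw [Finsupp.lmapDomain_apply, Finsupp.lmapDomain_apply, Finsupp.mapDomain_single,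
        chainBoundary_single, chainBoundary_single, ← Finsupp.lmapDomain_apply K K, map_smul,
        map_sum]
      refine congrArg (a • ·) (Finset.sum_congr rfl fun t _ => ?_)
      rw [map_smul, Finsupp.lmapDomain_apply, Finsupp.mapDomain_single]
      rfl
  rw [ReducedHomology, Submodule.Quotient.subsingleton_iff, Submodule.submoduleOf_eq_top]
  intro (z : (Fin m ↪o U) →₀ K) hz
  obtain ⟨w, hw, hwz⟩ := h (i m z) (hmem m z) (by
    cases m with
    | zero => trivial
    | succ m =>
      have hz : chainBoundary K m z = 0 := hz
      change chainBoundary K m (i (m + 1) z) = 0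
      rw [← hcomm, hz, map_zero])
  obtain ⟨w, rfl⟩ := hsurj _ w hw
  refine ⟨w, hi m ?_⟩
  rw [← hwz, ← hcomm]
  rfl

theorem IsSemimodularRelTo.isCohenMacaulayPoset [BoundedOrder P] [Finite P] {Z : P → Prop}
    (hZ : IsSemimodularRelTo Z) (K : Type*) [CommRing K] : IsCohenMacaulayPoset K P := by
  refine ⟨hZ.isPurePoset, fun x y hxy m hm => ?_⟩
  obtain ⟨l, rfl⟩ := Order.le_krullDim_iff.1 hm
  have hIoo : Set.Ioo x y = aboveBelow {s | x ⋖ s ∧ s ≤ y} y := by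
    ext v
    constructor
    · rintro ⟨hxv, hvy⟩
      obtain ⟨s, hs, hsv⟩ := exists_covBy_le_of_lt hxv
      exact ⟨hvy, s, ⟨hs, hsv.trans hvy.le⟩, hsv⟩
    · rintro ⟨hvy, s, hs, hsv⟩
      exact ⟨hs.1.lt.trans_le hsv, hvy⟩
  refine IsAcyclicAt.subsingleton_reducedHomology ?_
  generalize hk : l.length = k
  rw [hIoo]
  refine hZ.isAcyclicAt_aboveBelow K (x := x) (fun s hs => hs) (exists_covBy_le_of_lt hxy)
    (Or.inr fun g hg hgy _ => ⟨hg, hgy⟩) fun c hc => ?_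
  -- A chain in `(x, y)` is completed by `x` and `y`.
  let L : List P := l.toList.map Subtype.val ++ [y]
  have hL : List.IsChain (· < ·) (x :: L) := by
    rw [List.isChain_iff_pairwise, List.pairwise_cons, List.pairwise_append, List.pairwise_map,
      ← List.isChain_iff_pairwise]
    refine ⟨?_, l.isChain_toList, List.pairwise_singleton _ _, ?_⟩
    · simp only [L, List.mem_append, List.mem_map, List.mem_singleton]
      rintro _ (⟨v, -, rfl⟩ | rfl)
      exacts [v.2.1, hxy]
    · simp only [List.mem_map, List.mem_singleton]
      rintro _ ⟨v, -, rfl⟩ _ rfl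
      exact v.2.2
  obtain ⟨d, hd, hl⟩ := exists_isMaximalChainBetween_length_le hL (y := y) (by simp [L])
  rw [hZ.isPurePoset x y c d hc hd]
  simp only [L, List.length_append, List.length_map, RelSeries.length_toList,
    List.length_singleton, hk] at hl
  exact hl

end CohenMacaulay

namespace PointedPartitionB

variable {n : ℕ} {π ν : PointedPartitionB n} {a b c d p q : Fin n ⊕ Fin n} {D : Set (Fin n ⊕ Fin n)}

/-! ### Blocks and pointed elements -/

theorem part_swap_iff : π.part a.swap b.swap ↔ π.part a b :=
  ⟨fun h => by simpa using π.part_swap _ _ h, π.part_swap a b⟩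

theorem part_swap_left : π.part a.swap b ↔ π.part a b.swap := by
  rw [← part_swap_iff, Sum.swap_swap]

/-- `a` lies in the zero block. -/
def IsZero (π : PointedPartitionB n) (a : Fin n ⊕ Fin n) : Prop :=
  π.part a a.swap

theorem isZero_swap : π.IsZero a.swap ↔ π.IsZero a :=
  part_swap_iff

theorem IsZero.part (ha : π.IsZero a) (hb : π.IsZero b) : π.part a b :=
  π.zero_block a b ha hb

theorem IsZero.of_part (h : π.part a b) (ha : π.IsZero a) : π.IsZero b :=
  π.part.trans (π.part.trans (π.part.symm h) ha) (π.part_swap _ _ h)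

theorem IsZero.mono (h : π ≤ ν) (ha : π.IsZero a) : ν.IsZero a :=
  h.1 ha

theorem eq_of_part (hp : p ∈ π.pointed) (hq : q ∈ π.pointed) (h : π.part p q) : p = q :=
  (π.existsUnique_pointed p).unique ⟨hp, π.part.refl p⟩ ⟨hq, h⟩

theorem exists_pointed (π : PointedPartitionB n) (a : Fin n ⊕ Fin n) :
    ∃ p ∈ π.pointed, π.part a p :=
  (π.existsUnique_pointed a).exists

theorem swap_mem_pointed (hp : p ∈ π.pointed) (h : ¬ π.IsZero p) : p.swap ∈ π.pointed :=
  π.pointed_swap p hp h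

theorem exists_mem_pointed_of_lt (h : π < ν) : ∃ p ∈ π.pointed, p ∉ ν.pointed := by
  by_contra! H
  refine h.not_ge ⟨fun a b hab => ?_, H⟩
  obtain ⟨p, hp, hap⟩ := π.exists_pointed a
  obtain ⟨q, hq, hbq⟩ := π.exists_pointed b
  obtain rfl : p = q := eq_of_part (H p hp) (H q hq)
    (ν.part.trans (ν.part.symm (h.le.1 hap)) (ν.part.trans hab (h.le.1 hbq)))
  exact π.part.trans hap (π.part.symm hbq)

/-- There is a zero block. -/
def HasZeroBlock (π : PointedPartitionB n) : Prop :=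
  ∃ a, π.IsZero a

/-! ### The rank -/

/-- The pairs of opposite blocks other than the zero block, each represented by the index of its
pointed elements. -/
def nonzeroPairs (π : PointedPartitionB n) : Set (Fin n) :=
  {i | Sum.inl i ∈ π.pointed ∧ ¬ π.IsZero (Sum.inl i)}

/-- The index `i` of `±i`. -/
def index : Fin n ⊕ Fin n → Fin n :=
  Sum.elim id id

theorem index_eq_iff : index a = index b ↔ a = b ∨ a = b.swap := by
  rcases a with a | a <;> rcases b with b | b <;> simp [index]

theorem index_mem_nonzeroPairs : index a ∈ π.nonzeroPairs ↔ a ∈ π.pointed ∧ ¬ π.IsZero a := by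
  rcases a with i | i
  · rfl
  · refine ⟨fun h => ⟨π.pointed_swap _ h.1 h.2, fun h' => h.2 (isZero_swap.1 h')⟩, fun h => ?_⟩
    exact ⟨π.pointed_swap _ h.1 h.2, fun h' => h.2 (isZero_swap.1 h')⟩

/-- The number of pairs of opposite blocks other than the zero block: the corank in any maximal
interval. -/
noncomputable def corank (π : PointedPartitionB n) : ℕ :=
  π.nonzeroPairs.ncard

theorem nonzeroPairs_anti (h : π ≤ ν) : ν.nonzeroPairs ⊆ π.nonzeroPairs :=
  fun _ hi => ⟨h.2 hi.1, fun h' => hi.2 (h'.mono h)⟩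

theorem corank_lt (h : π < ν) : ν.corank < π.corank := by
  refine Set.ncard_lt_ncard ((nonzeroPairs_anti h.le).ssubset_of_not_subset fun H => ?_)
    (Set.toFinite _)
  obtain ⟨p, hp, hp'⟩ := exists_mem_pointed_of_lt h
  by_cases hz : π.IsZero p
  · -- If the zero block gets a new pointed element, this comes from another block.
    obtain ⟨q, hq, hpq⟩ := ν.exists_pointed p
    have hqz : ¬ π.IsZero q := fun hqz =>
      hp' (eq_of_part hp (h.le.2 hq) (hz.part hqz) ▸ hq)
    exact (index_mem_nonzeroPairs.1 (H (index_mem_nonzeroPairs.2 ⟨h.le.2 hq, hqz⟩))).2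
      ((hz.mono h.le).of_part hpq)
  · exact hp' (index_mem_nonzeroPairs.1 (H (index_mem_nonzeroPairs.2 ⟨hp, hz⟩))).1

theorem covBy_of_corank (h : π ≤ ν) (hr : π.corank = ν.corank + 1) : π ⋖ ν := by
  refine ⟨h.lt_of_ne (by rintro rfl; omega), fun w h₁ h₂ => ?_⟩
  have := corank_lt h₁
  have := corank_lt h₂
  omega

/-! ### Merging blocks -/

/-- The set `D` is a union of blocks, and either it is disjoint from `-D` or it is symmetric and
contains the zero block. Equivalently, the block partition remains of type `B` if the blocks in `D`
are merged, as well as those in `-D`. -/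
structure IsMergeable (π : PointedPartitionB n) (D : Set (Fin n ⊕ Fin n)) : Prop where
  mem_of_part : ∀ {a b}, π.part a b → a ∈ D → b ∈ D
  swap : (∀ a ∈ D, a.swap ∉ D) ∨ (∀ a ∈ D, a.swap ∈ D) ∧ ∀ a, π.IsZero a → a ∈ D

/-- The pointed partition obtained by merging the blocks in `D`, and those in `-D`, where `d` is
the pointed element of the new block `D`. -/
def merge (π : PointedPartitionB n) (D : Set (Fin n ⊕ Fin n)) (hD : π.IsMergeable D)
    (d : Fin n ⊕ Fin n) (hd : d ∈ D) (hdπ : d ∈ π.pointed) : PointedPartitionB n where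
  part :=
    { r := fun a b => π.part a b ∨ (a ∈ D ∧ b ∈ D) ∨ (a.swap ∈ D ∧ b.swap ∈ D)
      iseqv := by
        have h₁ : ∀ {a b}, π.part a b → (a ∈ D ↔ b ∈ D) := fun h =>
          ⟨hD.mem_of_part h, hD.mem_of_part (π.part.symm h)⟩
        have h₂ : ∀ {a b}, π.part a b → (a.swap ∈ D ↔ b.swap ∈ D) := fun h =>
          h₁ (part_swap_iff.2 h)
        refine ⟨fun a => Or.inl (π.part.refl a), ?_, ?_⟩
        · rintro a b (h | h | h)
          exacts [Or.inl (π.part.symm h), Or.inr (Or.inl h.symm), Or.inr (Or.inr h.symm)]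
        · rintro a b c (h | h | h) (h' | h' | h')
          · exact Or.inl (π.part.trans h h')
          · exact Or.inr (Or.inl ⟨(h₁ h).2 h'.1, h'.2⟩)
          · exact Or.inr (Or.inr ⟨(h₂ h).2 h'.1, h'.2⟩)
          · exact Or.inr (Or.inl ⟨h.1, (h₁ h').1 h.2⟩)
          · exact Or.inr (Or.inl ⟨h.1, h'.2⟩)
          · refine hD.swap.elim (fun H => absurd h'.1 (H _ h.2)) fun H => ?_
            exact Or.inr (Or.inl ⟨h.1, by simpa using H.1 _ h'.2⟩)
          · exact Or.inr (Or.inr ⟨h.1, (h₂ h').1 h.2⟩)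
          · refine hD.swap.elim (fun H => absurd h.2 (H _ h'.1)) fun H => ?_
            exact Or.inr (Or.inr ⟨h.1, H.1 _ h'.2⟩)
          · exact Or.inr (Or.inr ⟨h.1, h'.2⟩) }
  part_swap := by
    rintro a b (h | h | h)
    · exact Or.inl (π.part_swap _ _ h)
    · exact Or.inr (Or.inr (by simpa using h))
    · exact Or.inr (Or.inl h)
  zero_block := by
    have key : ∀ {a : Fin n ⊕ Fin n},
        π.part a a.swap ∨ (a ∈ D ∧ a.swap ∈ D) ∨ (a.swap ∈ D ∧ a.swap.swap ∈ D) →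
        π.IsZero a ∨ a ∈ D ∧ a.swap ∈ D := by
      rintro a (h | h | h)
      exacts [Or.inl h, Or.inr h, Or.inr (by simpa using h.symm)]
    intro a b ha hb
    rcases hD.swap with H | H
    · refine Or.inl (π.zero_block a b ?_ ?_)
      · exact (key ha).resolve_right fun h => H _ h.1 h.2
      · exact (key hb).resolve_right fun h => H _ h.1 h.2
    · exact Or.inr (Or.inl ⟨(key ha).elim (H.2 a) And.left, (key hb).elim (H.2 b) And.left⟩)
  pointed := {p | p ∈ π.pointed ∧ (p ∈ D → p = d) ∧ (p ∉ D → p.swap ∈ D → p.swap = d)}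
  existsUnique_pointed := by
    intro a
    by_cases ha : a ∈ D
    · refine ⟨d, ⟨⟨hdπ, fun _ => rfl, fun h => absurd hd h⟩, Or.inr (Or.inl ⟨ha, hd⟩)⟩, ?_⟩
      rintro q ⟨⟨-, hq, -⟩, h | h | h⟩
      · exact hq (hD.mem_of_part h ha)
      · exact hq h.2
      · refine hD.swap.elim (fun H => absurd h.1 (H _ ha)) fun H => ?_
        exact hq (by simpa using H.1 _ h.2)
    by_cases ha' : a.swap ∈ D
    · have H : ∀ a ∈ D, a.swap ∉ D := hD.swap.resolve_right fun H =>
        ha (by simpa using H.1 _ ha')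
      have hd' : d.swap ∉ D := H d hd
      refine ⟨d.swap, ⟨⟨swap_mem_pointed hdπ fun h => hd' (hD.mem_of_part h hd), ?_, ?_⟩, ?_⟩, ?_⟩
      · exact fun h => absurd h hd'
      · exact fun _ _ => Sum.swap_swap d
      · exact Or.inr (Or.inr ⟨ha', by simpa using hd⟩)
      · have key : ∀ {q : Fin n ⊕ Fin n}, q.swap ∈ D → (q ∉ D → q.swap ∈ D → q.swap = d) →
            q = d.swap := fun {q} hq h => by
          rw [← h (fun h' => H _ h' hq) hq, Sum.swap_swap]
        rintro q ⟨⟨-, -, hq⟩, h | h | h⟩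
        · exact key (hD.mem_of_part (part_swap_iff.2 h) ha') hq
        · exact absurd h.1 ha
        · exact key h.2 hq
    · obtain ⟨p, hp, hap⟩ := π.exists_pointed a
      refine ⟨p, ⟨⟨hp, ?_, ?_⟩, Or.inl hap⟩, ?_⟩
      · exact fun h => absurd (hD.mem_of_part (π.part.symm hap) h) ha
      · exact fun _ h => absurd (hD.mem_of_part (part_swap_iff.2 (π.part.symm hap)) h) ha'
      · rintro q ⟨⟨hq, -⟩, h | h | h⟩
        · exact eq_of_part hq hp (π.part.trans (π.part.symm h) hap)
        · exact absurd h.1 ha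
        · exact absurd h.1 ha'
  pointed_swap := by
    rintro p ⟨hp, hpd, hpd'⟩ h
    refine ⟨π.pointed_swap p hp fun h' => h (Or.inl h'), fun hp' => ?_, fun _ hp' => ?_⟩
    · exact hpd' (fun hpD => h (Or.inr (Or.inl ⟨hpD, hp'⟩))) hp'
    · rw [Sum.swap_swap] at hp' ⊢
      exact hpd hp'

section Merge

variable {hD : π.IsMergeable D} {hd : d ∈ D} {hdπ : d ∈ π.pointed}

theorem part_merge : (π.merge D hD d hd hdπ).part a b ↔
    π.part a b ∨ (a ∈ D ∧ b ∈ D) ∨ (a.swap ∈ D ∧ b.swap ∈ D) :=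
  Iff.rfl

theorem mem_pointed_merge : p ∈ (π.merge D hD d hd hdπ).pointed ↔
    p ∈ π.pointed ∧ (p ∈ D → p = d) ∧ (p ∉ D → p.swap ∈ D → p.swap = d) :=
  Iff.rfl

theorem isZero_merge : (π.merge D hD d hd hdπ).IsZero a ↔ π.IsZero a ∨ a ∈ D ∧ a.swap ∈ D := by
  rw [IsZero, part_merge, Sum.swap_swap, and_comm (a := a.swap ∈ D), or_self]
  rfl

theorem le_merge : π ≤ π.merge D hD d hd hdπ :=
  ⟨fun _ _ h => Or.inl h, fun _ h => h.1⟩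

theorem merge_part_le (h : π ≤ ν) (hν : ∀ c ∈ D, ν.part d c) :
    (π.merge D hD d hd hdπ).part ≤ ν.part := by
  rintro a b (hab | hab | hab)
  · exact h.1 hab
  · exact ν.part.trans (ν.part.symm (hν a hab.1)) (hν b hab.2)
  · exact part_swap_iff.1 (ν.part.trans (ν.part.symm (hν _ hab.1)) (hν _ hab.2))

end Merge

/-- The block containing `a` and `b` that results if `a` and `b` are identified. If `a` or `b` is in
the zero block, or if `a` and `-b` are equivalent, this is the zero block of the result, and it
contains the previous zero block, if any. -/
def glue (π : PointedPartitionB n) (a b : Fin n ⊕ Fin n) : Set (Fin n ⊕ Fin n) :=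
  {c | π.part a c ∨ π.part b c ∨ (π.IsZero a ∨ π.IsZero b ∨ π.part a b.swap) ∧
    (π.IsZero c ∨ π.part a c.swap ∨ π.part b c.swap)}

theorem isMergeable_glue (π : PointedPartitionB n) (a b : Fin n ⊕ Fin n) :
    π.IsMergeable (π.glue a b) := by
  constructor
  · rintro c d hcd (h | h | ⟨h, h' | h' | h'⟩)
    · exact Or.inl (π.part.trans h hcd)
    · exact Or.inr (Or.inl (π.part.trans h hcd))
    · exact Or.inr (Or.inr ⟨h, Or.inl (h'.of_part hcd)⟩)
    · exact Or.inr (Or.inr ⟨h, Or.inr (Or.inl (π.part.trans h' (part_swap_iff.2 hcd)))⟩)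
    · exact Or.inr (Or.inr ⟨h, Or.inr (Or.inr (π.part.trans h' (part_swap_iff.2 hcd)))⟩)
  by_cases hz : π.IsZero a ∨ π.IsZero b ∨ π.part a b.swap
  · refine Or.inr ⟨?_, fun c hc => Or.inr (Or.inr ⟨hz, Or.inl hc⟩)⟩
    rintro c (h | h | ⟨-, h | h | h⟩)
    · exact Or.inr (Or.inr ⟨hz, Or.inr (Or.inl (by simpa using h))⟩)
    · exact Or.inr (Or.inr ⟨hz, Or.inr (Or.inr (by simpa using h))⟩)
    · exact Or.inr (Or.inr ⟨hz, Or.inl (isZero_swap.2 h)⟩)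
    · exact Or.inl h
    · exact Or.inr (Or.inl h)
  · refine Or.inl ?_
    rintro c (h | h | ⟨h, -⟩) (h' | h' | ⟨h', -⟩)
    · exact hz (Or.inl (π.part.trans h' (part_swap_iff.2 (π.part.symm h))))
    · exact hz (Or.inr (Or.inr (π.part.trans h (part_swap_left.1 (π.part.symm h')))))
    · exact hz h'
    · exact hz (Or.inr (Or.inr (π.part.trans h' (part_swap_iff.2 (π.part.symm h)))))
    · exact hz (Or.inr (Or.inl (π.part.trans h' (part_swap_iff.2 (π.part.symm h)))))
    · exact hz h'
    · exact hz h
    · exact hz h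
    · exact hz h

theorem part_of_mem_glue (h : π ≤ ν) (hab : ν.part a b) (hc : c ∈ π.glue a b) : ν.part a c := by
  rcases hc with hc | hc | ⟨hz, hc⟩
  · exact h.1 hc
  · exact ν.part.trans hab (h.1 hc)
  have ha : ν.IsZero a := by
    rcases hz with hz | hz | hz
    · exact hz.mono h
    · exact (hz.mono h).of_part (ν.part.symm hab)
    · exact ν.part.trans (h.1 hz) (part_swap_iff.2 (ν.part.symm hab))
  rcases hc with hc | hc | hc
  · exact ha.part (hc.mono h)
  · exact ha.part (isZero_swap.1 (ha.of_part (h.1 hc)))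
  · exact ha.part (isZero_swap.1 ((ha.of_part hab).of_part (h.1 hc)))

/-- Merging the blocks of two pointed elements eliminates only one pair of blocks. -/
theorem exists_nonzeroPairs_merge_glue (ha : a ∈ π.pointed) (hb : b ∈ π.pointed)
    {hd : d ∈ π.glue a b} {hdπ : d ∈ π.pointed} :
    ∃ e, ∀ p ∈ π.pointed, ¬ π.IsZero p → p = e ∨ p = e.swap ∨
      index p ∈ (π.merge (π.glue a b) (π.isMergeable_glue a b) d hd hdπ).nonzeroPairs := by
  have hab : ∀ {p}, p ∈ π.pointed → ¬ π.IsZero p → p ∈ π.glue a b →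
      (p = a ∨ p = b) ∨
        (π.IsZero a ∨ π.IsZero b ∨ π.part a b.swap) ∧ (p.swap = a ∨ p.swap = b) := by
    rintro p hp hpz (h | h | ⟨hz, h | h | h⟩)
    · exact Or.inl (Or.inl (eq_of_part ha hp h).symm)
    · exact Or.inl (Or.inr (eq_of_part hb hp h).symm)
    · exact absurd h hpz
    · exact Or.inr ⟨hz, Or.inl (eq_of_part ha (swap_mem_pointed hp hpz) h).symm⟩
    · exact Or.inr ⟨hz, Or.inr (eq_of_part hb (swap_mem_pointed hp hpz) h).symm⟩
  have hswap : ∀ {p q : Fin n ⊕ Fin n}, p.swap = q → p = q.swap := fun h => by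
    rw [← h, Sum.swap_swap]
  simp only [index_mem_nonzeroPairs, mem_pointed_merge, isZero_merge]
  rcases (π.isMergeable_glue a b).swap with H | H
  · -- The new block is not the zero block, and contains only `a` and `b` as old pointed elements.
    have hN : ∀ {p}, p ∈ π.pointed → p ∈ π.glue a b → p = a ∨ p = b := by
      intro p hp hpD
      have hpz : ¬ π.IsZero p := fun h => H p hpD ((π.isMergeable_glue a b).mem_of_part h hpD)
      refine (hab hp hpz hpD).resolve_right fun h => H p hpD ?_
      rcases h.2 with h | h <;> rw [h]
      exacts [Or.inl (π.part.refl a), Or.inr (Or.inl (π.part.refl b))]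
    obtain ⟨e, he⟩ : ∃ e, ∀ p ∈ π.pointed, p ∈ π.glue a b → p = e ∨ p = d := by
      rcases hN hdπ hd with rfl | rfl
      · exact ⟨b, fun p hp hpD => (hN hp hpD).symm⟩
      · exact ⟨a, fun p hp hpD => hN hp hpD⟩
    refine ⟨e, fun p hp hpz => ?_⟩
    by_cases hpe : p = e
    · exact Or.inl hpe
    by_cases hpe' : p = e.swap
    · exact Or.inr (Or.inl hpe')
    refine Or.inr (Or.inr ⟨⟨hp, fun h => (he p hp h).resolve_left hpe, fun _ h => ?_⟩, ?_⟩)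
    · exact (he _ (swap_mem_pointed hp hpz) h).resolve_left fun h => hpe' (hswap h)
    · rintro (h | h)
      exacts [hpz h, H p h.1 h.2]
  · by_cases hz : π.IsZero a ∨ π.IsZero b ∨ π.part a b.swap
    · obtain ⟨e, he⟩ : ∃ e, ∀ p ∈ π.pointed, ¬ π.IsZero p → p ∈ π.glue a b →
          p = e ∨ p = e.swap := by
        have hab' : ∀ {p}, p ∈ π.pointed → ¬ π.IsZero p → p ∈ π.glue a b →
            p = a ∨ p = b ∨ p = a.swap ∨ p = b.swap := by
          intro p hp hpz hpD
          rcases hab hp hpz hpD with (h | h) | ⟨-, h | h⟩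
          exacts [Or.inl h, Or.inr (Or.inl h), Or.inr (Or.inr (Or.inl (hswap h))),
            Or.inr (Or.inr (Or.inr (hswap h)))]
        by_cases haz : π.IsZero a
        · refine ⟨b, fun p hp hpz hpD => ?_⟩
          rcases hab' hp hpz hpD with rfl | h | rfl | h
          exacts [absurd haz hpz, Or.inl h, absurd (isZero_swap.2 haz) hpz, Or.inr h]
        · refine ⟨a, fun p hp hpz hpD => ?_⟩
          have hb' : p = b ∨ p = b.swap → b = a.swap := by
            intro h
            have hbz : ¬ π.IsZero b := by
              rcases h with rfl | rfl
              exacts [hpz, fun h => hpz (isZero_swap.2 h)]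
            have hz' := (hz.resolve_left haz).resolve_left hbz
            rw [eq_of_part ha (swap_mem_pointed hb hbz) hz', Sum.swap_swap]
          rcases hab' hp hpz hpD with h | h | h | h
          · exact Or.inl h
          · exact Or.inr (h.trans (hb' (Or.inl h)))
          · exact Or.inr h
          · exact Or.inl (by rw [h, hb' (Or.inr h), Sum.swap_swap])
      refine ⟨e, fun p hp hpz => ?_⟩
      by_cases hpD : p ∈ π.glue a b
      · exact (he p hp hpz hpD).imp_right Or.inl
      have hpD' : p.swap ∉ π.glue a b := fun h => hpD (by simpa using H.1 _ h)
      exact Or.inr (Or.inr ⟨⟨hp, fun h => absurd h hpD, fun _ h => absurd h hpD'⟩,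
        fun h => h.elim hpz fun h => hpD h.1⟩)
    · -- A symmetric block is the zero block.
      refine absurd ?_ hz
      rcases H.1 a (Or.inl (π.part.refl a)) with h | h | ⟨h, -⟩
      · exact Or.inl h
      · exact Or.inr (Or.inr (part_swap_left.1 (π.part.symm h)))
      · exact h

theorem corank_le_merge_glue (ha : a ∈ π.pointed) (hb : b ∈ π.pointed)
    {hd : d ∈ π.glue a b} {hdπ : d ∈ π.pointed} :
    π.corank ≤ (π.merge (π.glue a b) (π.isMergeable_glue a b) d hd hdπ).corank + 1 := by
  obtain ⟨e, he⟩ := exists_nonzeroPairs_merge_glue ha hb (hd := hd) (hdπ := hdπ)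
  refine le_trans (Set.ncard_le_ncard (t := insert (index e) _) ?_ (Set.toFinite _))
    (Set.ncard_insert_le _ _)
  intro i hi
  have := he (Sum.inl i) hi.1 hi.2
  rw [← or_assoc, ← index_eq_iff] at this
  exact this

/-- Two distinct pointed elements of `π` that are equivalent in some `y ≥ π` can be identified by
a cover of `π` below `y`. Unless the pointed element of the new block is forced by `y`, it may be
any pointed element `d` of `π` in this block; by means of a set `V ∋ d` of permitted pointed
elements, this is expressed without distinguishing these cases. -/
theorem exists_covBy_glue {y : PointedPartitionB n} (hy : π ≤ y) (ha : a ∈ π.pointed)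
    (hb : b ∈ π.pointed) (hab : a ≠ b) (hyab : y.part a b) {V : Set (Fin n ⊕ Fin n)}
    (hyV : y.pointed ⊆ V) (hd : d ∈ π.glue a b) (hdπ : d ∈ π.pointed) (hdV : d ∈ V) :
    ∃ w ≤ y, π ⋖ w ∧ π.corank = w.corank + 1 ∧ w.part a b ∧
      (∀ ν, π ≤ ν → ν.part a b → w.part ≤ ν.part) ∧
      ∀ s ∈ w.pointed, s ∈ V ∨ (s.swap ∈ V ∧ ¬ w.IsZero s) ∨ ∀ t, w.part s t → π.part s t := by
  have hM := π.isMergeable_glue a b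
  obtain ⟨c, hc, hac⟩ := y.exists_pointed a
  have hcy : ∀ {e}, e ∈ y.pointed → e ∈ π.glue a b → e = c := fun he heD =>
    eq_of_part he hc (y.part.trans (y.part.symm (part_of_mem_glue hy hyab heD)) hac)
  -- The pointed element of the new block, or its opposite, is that of `y` if possible.
  obtain ⟨d', hd', hd'π, hcd, hcd', hV⟩ : ∃ d' ∈ π.glue a b, d' ∈ π.pointed ∧
      (c ∈ π.glue a b → c = d') ∧ (c ∉ π.glue a b → c.swap ∈ π.glue a b → c.swap = d') ∧
      (d' ∈ V ∨ d'.swap ∈ V ∧ d'.swap ∉ π.glue a b) := by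
    by_cases h : c ∈ π.glue a b
    · exact ⟨c, h, hy.2 hc, fun _ => rfl, fun h' => absurd h h', Or.inl (hyV hc)⟩
    by_cases h' : c.swap ∈ π.glue a b
    · refine ⟨c.swap, h', swap_mem_pointed (hy.2 hc) fun hz => h ?_, fun h₁ => absurd h₁ h,
        fun _ _ => rfl, Or.inr ?_⟩
      · exact hM.mem_of_part (π.part.symm hz) h'
      · rw [Sum.swap_swap]
        exact ⟨hyV hc, h⟩
    · exact ⟨d, hd, hdπ, fun h₁ => absurd h₁ h, fun _ h₁ => absurd h₁ h', Or.inl hdV⟩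
  set w := π.merge (π.glue a b) hM d' hd' hd'π with hw
  have hglue : ∀ {ν}, π ≤ ν → ν.part a b → w.part ≤ ν.part := fun {ν} h₁ h₂ =>
    merge_part_le h₁ fun e he =>
      ν.part.trans (ν.part.symm (part_of_mem_glue h₁ h₂ hd')) (part_of_mem_glue h₁ h₂ he)
  have hπw : π ≤ w := le_merge
  have hwab : w.part a b :=
    Or.inr (Or.inl ⟨Or.inl (π.part.refl a), Or.inr (Or.inl (π.part.refl b))⟩)
  have hlt : π < w := hπw.lt_of_ne fun h => hab (eq_of_part ha hb (h ▸ hwab))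
  have hrank : π.corank = w.corank + 1 := by
    have h₁ := corank_lt hlt
    have h₂ : π.corank ≤ w.corank + 1 := corank_le_merge_glue ha hb
    omega
  refine ⟨w, ⟨hglue hy hyab, fun e he => ⟨hy.2 he, ?_, ?_⟩⟩, covBy_of_corank hπw hrank, hrank, hwab,
    fun ν h₁ h₂ => hglue h₁ h₂, ?_⟩
  · intro heD
    obtain rfl := hcy he heD
    exact hcd heD
  · intro heD heD'
    by_cases hez : y.IsZero e
    · obtain rfl : e = c := eq_of_part he hc (y.part.trans hez
        (y.part.trans (y.part.symm (part_of_mem_glue hy hyab heD')) hac))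
      exact hcd' heD heD'
    · have h := hcy (swap_mem_pointed he hez) heD'
      rw [h] at heD' ⊢
      exact hcd heD'
  · rintro s ⟨hs, hsD, hsD'⟩
    by_cases h : s ∈ π.glue a b
    · obtain rfl := hsD h
      refine hV.imp_right fun hV => Or.inl ⟨hV.1, fun hz => hV.2 ?_⟩
      rcases isZero_merge.1 hz with hz | hz
      exacts [hM.mem_of_part hz h, hz.2]
    by_cases h' : s.swap ∈ π.glue a b
    · obtain rfl := hsD' h h'
      rw [Sum.swap_swap] at hV
      rcases hV with hV | hV
      · refine Or.inr (Or.inl ⟨hV, fun hz => h ?_⟩)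
        rcases isZero_merge.1 hz with hz | hz
        exacts [hM.mem_of_part (π.part.symm hz) h', hz.1]
      · exact Or.inl hV.1
    · refine Or.inr (Or.inr fun t ht => ?_)
      rcases ht with ht | ht | ht
      exacts [ht, absurd ht.1 h, absurd ht.1 h']

end PointedPartitionB

namespace PointedPartitionB

variable {n : ℕ} {x u v w y ν : PointedPartitionB n} {a b p q s t : Fin n ⊕ Fin n}

/-! ### Covers -/

theorem eq_of_covBy_of_le (hv : x ⋖ v) (hw : x ⋖ w) (hwv : w ≤ v) : w = v :=
  hwv.eq_of_not_lt (hv.2 hw.lt)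

theorem corank_eq_of_covBy (h : x ⋖ v) : x.corank = v.corank + 1 := by
  obtain ⟨p, hp, hpv⟩ := exists_mem_pointed_of_lt h.lt
  obtain ⟨q, hq, hpq⟩ := v.exists_pointed p
  obtain ⟨w, hw, hxw, hr, -⟩ := exists_covBy_glue h.le hp (h.le.2 hq)
    (by rintro rfl; exact hpv hq) hpq (Set.subset_univ _) (Or.inl (x.part.refl p)) hp trivial
  rwa [eq_of_covBy_of_le h hxw hw] at hr

/-- The partition of a cover of `x` is generated by any pair of blocks of `x` that it merges. -/
theorem part_le_of_covBy (h : x ⋖ v) (hs : s ∈ x.pointed) (ht : t ∈ x.pointed) (hst : s ≠ t)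
    (hvst : v.part s t) (hν : x ≤ ν) (hνst : ν.part s t) : v.part ≤ ν.part := by
  obtain ⟨w, hw, hxw, -, -, hgen, -⟩ := exists_covBy_glue h.le hs ht hst hvst (Set.subset_univ _)
    (Or.inl (x.part.refl s)) hs trivial
  rw [← eq_of_covBy_of_le h hxw hw]
  exact hgen ν hν hνst

/-- A cover eliminates only one pair of blocks. -/
theorem eq_or_eq_swap_of_covBy (h : x ⋖ v) (hs : s ∈ x.pointed) (hsx : ¬ x.IsZero s)
    (hsv : s ∈ v.pointed → v.IsZero s) (ht : t ∈ x.pointed) (htx : ¬ x.IsZero t)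
    (htv : t ∈ v.pointed → v.IsZero t) : s = t ∨ s = t.swap := by
  rw [← index_eq_iff]
  by_contra hne
  have hs' : index s ∉ v.nonzeroPairs := fun h' =>
    (index_mem_nonzeroPairs.1 h').2 (hsv (index_mem_nonzeroPairs.1 h').1)
  have ht' : index t ∉ v.nonzeroPairs := fun h' =>
    (index_mem_nonzeroPairs.1 h').2 (htv (index_mem_nonzeroPairs.1 h').1)
  have hsub : insert (index s) (insert (index t) v.nonzeroPairs) ⊆ x.nonzeroPairs := by
    rintro i (rfl | rfl | hi)
    exacts [index_mem_nonzeroPairs.2 ⟨hs, hsx⟩, index_mem_nonzeroPairs.2 ⟨ht, htx⟩,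
      nonzeroPairs_anti h.le hi]
  have hcard := Set.ncard_le_ncard hsub (Set.toFinite _)
  rw [Set.ncard_insert_of_notMem (fun h' => h'.elim hne hs') (Set.toFinite _),
    Set.ncard_insert_of_notMem ht' (Set.toFinite _)] at hcard
  have hr := corank_eq_of_covBy h
  rw [corank, corank] at hr
  omega

/-- If the zero block gets a new pointed element, this is opposite to that of the other block which
is absorbed. -/
theorem swap_mem_pointed_of_covBy (h : x ⋖ v) (hs : s ∈ x.pointed) (hsx : x.IsZero s)
    (hsv : s ∉ v.pointed) (ht : t ∈ x.pointed) (htx : ¬ x.IsZero t) (htv : t ∉ v.pointed) :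
    t.swap ∈ v.pointed ∧ v.IsZero t := by
  obtain ⟨q, hq, hsq⟩ := v.exists_pointed s
  have hqx : ¬ x.IsZero q := fun hqx => hsv (eq_of_part hs (h.le.2 hq) (hsx.part hqx) ▸ hq)
  have hqv : v.IsZero q := (hsx.mono h.le).of_part hsq
  obtain rfl : q = t.swap := (eq_or_eq_swap_of_covBy h (h.le.2 hq) hqx (fun _ => hqv) ht htx
    fun h' => absurd h' htv).resolve_left (by rintro rfl; exact htv hq)
  exact ⟨hq, isZero_swap.1 hqv⟩

/-- All elements that cease to be pointed in a cover lie in the merged block or its opposite. -/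
theorem part_or_part_swap_of_covBy (h : x ⋖ v) (hs : s ∈ x.pointed) (hsv : s ∉ v.pointed)
    (ht : t ∈ x.pointed) (htv : t ∉ v.pointed) : v.part s t ∨ v.part s t.swap := by
  by_cases hsx : x.IsZero s <;> by_cases htx : x.IsZero t
  · exact Or.inl (h.le.1 (hsx.part htx))
  · exact Or.inl ((hsx.mono h.le).part (swap_mem_pointed_of_covBy h hs hsx hsv ht htx htv).2)
  · exact Or.inl ((swap_mem_pointed_of_covBy h ht htx htv hs hsx hsv).2.part (htx.mono h.le))
  · rcases eq_or_eq_swap_of_covBy h hs hsx (fun h' => absurd h' hsv) ht htx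
      (fun h' => absurd h' htv) with rfl | rfl
    exacts [Or.inl (v.part.refl _), Or.inr (v.part.refl _)]

/-! ### Common covers -/

theorem mem_pointed_of_swap_mem (hvw : v.part ≤ w.part) (hs : s.swap ∈ v.pointed)
    (hsw : ¬ w.IsZero s) : s ∈ v.pointed := by
  rw [← Sum.swap_swap s]
  exact swap_mem_pointed hs fun hz => hsw (hvw (isZero_swap.1 hz))

/-- Two covers with the same partition: an element `s` that is pointed in one of them only can be
absorbed into the block that contains it in `y`. -/
theorem exists_join_of_part_le (hu : x ⋖ u) (hv : x ⋖ v) (huv : u ≠ v) (huy : u ≤ y) (hvy : v ≤ y)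
    (hvu : v.part ≤ u.part) : ∃ w ≤ y, u ⋖ w ∧ v ≤ w := by
  obtain ⟨s, hs, hsv⟩ : ∃ s ∈ u.pointed, s ∉ v.pointed := by
    by_contra! H
    exact huv (eq_of_covBy_of_le hu hv ⟨hvu, H⟩).symm
  obtain ⟨c, hc, hsc⟩ := y.exists_pointed s
  have hsc' : s ≠ c := by
    rintro rfl
    exact hsv (hvy.2 hc)
  obtain ⟨w, hwy, huw, -, hwsc, -, hw⟩ := exists_covBy_glue huy hs (huy.2 hc) hsc' hsc
    hvy.2 (Or.inr (Or.inl (u.part.refl c))) (huy.2 hc) (hvy.2 hc)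
  have hvw := hvu.trans huw.le.1
  refine ⟨w, hwy, huw, hvw, fun t ht => ?_⟩
  have key : (∀ t', w.part t t' → u.part t t') → t ∈ v.pointed := by
    intro htw
    by_contra htv
    have htu := huw.le.2 ht
    have hne : ∀ t', w.part t t' → w.part t' s → w.part t' c → False := by
      intro t' h₁ h₂ h₃
      refine hsc' (eq_of_part hs (huy.2 hc) (u.part.trans (u.part.symm (htw s ?_)) (htw c ?_)))
      exacts [w.part.trans h₁ h₂, w.part.trans h₁ h₃]
    rcases part_or_part_swap_of_covBy hv (hu.le.2 htu) htv (hu.le.2 hs) hsv with h | h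
    · exact hne s (hvw h) (w.part.refl s) hwsc
    · have hu₁ : u.part t c.swap := htw _ (w.part.trans (hvw h) (w.part_swap _ _ hwsc))
      have hu₂ : u.part t s.swap := htw _ (hvw h)
      exact hsc' (eq_of_part hs (huy.2 hc) (part_swap_iff.1
        (u.part.trans (u.part.symm hu₂) hu₁)))
  rcases hw t ht with h | h | h
  exacts [h, mem_pointed_of_swap_mem hvw h.1 h.2, key h]

/-- If `v` identifies `p` and `q`, which lie in different blocks of `u` with pointed elements `a`
and `b`, then among the elements of `u.pointed` that lie in the block resulting from the identification
of `a` and `b`, one is still pointed in `v`, provided that `y` has a zero block only if `u` has.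
Otherwise `u` and `v` might identify `p` with `-q` and with `q`, respectively, without keeping a
common pointed element. -/
theorem exists_mem_glue (hu : x ⋖ u) (hv : x ⋖ v)
    (h : u.HasZeroBlock ∨ ¬ y.HasZeroBlock) (hp : p ∈ x.pointed) (hpv : p ∉ v.pointed)
    (hq : q ∈ v.pointed) (hpq : v.part p q) (ha : a ∈ u.pointed) (hpa : u.part p a)
    (hb : b ∈ u.pointed) (hqb : u.part q b) (hab : a ≠ b) (hyab : y.part a b) :
    ∃ d ∈ u.glue a b, d ∈ u.pointed ∧ d ∈ v.pointed := by
  by_cases hav : a ∈ v.pointed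
  · exact ⟨a, Or.inl (u.part.refl a), ha, hav⟩
  by_cases hbv : b ∈ v.pointed
  · exact ⟨b, Or.inr (Or.inl (u.part.refl b)), hb, hbv⟩
  have hax := hu.le.2 ha
  have hbx := hu.le.2 hb
  have hpb : p ≠ b := by
    rintro rfl
    exact hab (eq_of_part hb ha hpa).symm
  have hqv : ∀ {c}, c.swap ∈ v.pointed → v.IsZero c → v.IsZero p → q = c.swap := fun hc hcz hpz =>
    eq_of_part hq hc (v.part.trans (v.part.symm hpq) (hpz.part (isZero_swap.2 hcz)))
  have hlost : ∀ {c}, c ∈ x.pointed → c ∉ v.pointed → ¬ x.IsZero c → ¬ x.IsZero p →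
      p = c ∨ p = c.swap := fun hc hcv hcx hpx =>
    eq_or_eq_swap_of_covBy hv hp hpx (fun h' => absurd h' hpv) hc hcx fun h' => absurd h' hcv
  have hzero : ¬ (u.IsZero a ∧ u.IsZero b) := fun h => hab (eq_of_part ha hb (h.1.part h.2))
  by_cases hazx : x.IsZero a
  · have hbzx : ¬ x.IsZero b := fun hbzx => hzero ⟨hazx.mono hu.le, hbzx.mono hu.le⟩
    obtain ⟨hb', hbz⟩ := swap_mem_pointed_of_covBy hv hax hazx hav hbx hbzx hbv
    by_cases hpz : x.IsZero p
    · rw [hqv hb' hbz (hpz.mono hv.le)] at hqb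
      exact absurd ⟨hazx.mono hu.le, u.part.symm hqb⟩ hzero
    · rcases hlost hbx hbv hbzx hpz with rfl | rfl
      exacts [absurd rfl hpb, absurd hb' hpv]
  by_cases hbzx : x.IsZero b
  · obtain ⟨ha', haz⟩ := swap_mem_pointed_of_covBy hv hbx hbzx hbv hax hazx hav
    by_cases hpz : x.IsZero p
    · exact absurd (eq_of_part hp hbx (hpz.part hbzx)) hpb
    · rcases hlost hax hav hazx hpz with rfl | rfl
      · rw [hqv ha' haz haz] at hqb
        have := (hbzx.mono hu.le).of_part (u.part.symm hqb)
        exact absurd ⟨isZero_swap.1 this, hbzx.mono hu.le⟩ hzero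
      · exact absurd ha' hpv
  -- Now `b = -a`, and the zero block of `u` provides the element.
  have hba : b = a.swap := by
    refine (eq_or_eq_swap_of_covBy hv hbx hbzx (fun h' => absurd h' hbv) hax hazx
      fun h' => absurd h' hav).resolve_left hab.symm
  subst hba
  obtain ⟨ζ, hζ⟩ := h.resolve_right fun h => h ⟨a, hyab⟩
  obtain ⟨z, hz, hζz⟩ := u.exists_pointed ζ
  have hzu : u.IsZero z := hζ.of_part hζz
  refine ⟨z, Or.inr (Or.inr ⟨Or.inr (Or.inr ?_), Or.inl hzu⟩), hz, ?_⟩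
  · rw [Sum.swap_swap]
  by_contra hzv
  by_cases hzx : x.IsZero z
  · exact hbv (swap_mem_pointed_of_covBy hv (hu.le.2 hz) hzx hzv hax hazx hav).1
  · have haz : u.IsZero a := by
      rcases eq_or_eq_swap_of_covBy hv (hu.le.2 hz) hzx (fun h' => absurd h' hzv) hax hazx
        (fun h' => absurd h' hav) with rfl | rfl
      exacts [hzu, isZero_swap.1 hzu]
    exact hzero ⟨haz, isZero_swap.2 haz⟩

/-- Two covers of `x` below `y` have a common cover below `y` unless `y` has a zero block that `u`
does not have. -/
theorem exists_join (hu : x ⋖ u) (hv : x ⋖ v) (huv : u ≠ v) (huy : u ≤ y) (hvy : v ≤ y)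
    (h : u.HasZeroBlock ∨ ¬ y.HasZeroBlock) : ∃ w ≤ y, u ⋖ w ∧ v ⋖ w := by
  -- As all covers decrease the corank by `1`, an upper bound of `v` that covers `u` covers `v`.
  suffices H : ∃ w ≤ y, u ⋖ w ∧ v ≤ w by
    obtain ⟨w, hwy, huw, hvw⟩ := H
    refine ⟨w, hwy, huw, covBy_of_corank hvw ?_⟩
    have := corank_eq_of_covBy hu
    have := corank_eq_of_covBy hv
    have := corank_eq_of_covBy huw
    omega
  obtain ⟨p, hp, hpv⟩ := exists_mem_pointed_of_lt hv.lt
  obtain ⟨q, hq, hpq⟩ := v.exists_pointed p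
  have hne : p ≠ q := by
    rintro rfl
    exact hpv hq
  by_cases hupq : u.part p q
  · exact exists_join_of_part_le hu hv huv huy hvy
      (part_le_of_covBy hv hp (hv.le.2 hq) hne hpq hu.le hupq)
  obtain ⟨a, ha, hpa⟩ := u.exists_pointed p
  obtain ⟨b, hb, hqb⟩ := u.exists_pointed q
  have hab : a ≠ b := by
    rintro rfl
    exact hupq (u.part.trans hpa (u.part.symm hqb))
  -- The cover `w` of `u` identifies `a` and `b`, hence also `p` and `q`, as `v` does.
  have hyab : y.part a b :=
    y.part.trans (y.part.symm (huy.1 hpa)) (y.part.trans (hvy.1 hpq) (huy.1 hqb))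
  obtain ⟨d, hd, hdu, hdv⟩ := exists_mem_glue hu hv h hp hpv hq hpq ha hpa hb hqb hab hyab
  obtain ⟨w, hwy, huw, -, hwab, -, hw⟩ := exists_covBy_glue huy ha hb hab hyab hvy.2 hd hdu hdv
  have hwpq : w.part p q :=
    w.part.trans (huw.le.1 hpa) (w.part.trans hwab (w.part.symm (huw.le.1 hqb)))
  have hvw : v.part ≤ w.part :=
    part_le_of_covBy hv hp (hv.le.2 hq) hne hpq (hu.le.trans huw.le) hwpq
  refine ⟨w, hwy, huw, hvw, fun s hs => ?_⟩
  have key : (∀ t, w.part s t → u.part s t) → s ∈ v.pointed := by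
    intro hsw
    by_contra hsv
    obtain ⟨t, ht, hst⟩ := v.exists_pointed s
    refine hupq (part_le_of_covBy hv (hu.le.2 (huw.le.2 hs)) (hv.le.2 ht) ?_ hst hu.le
      (hsw t (hvw hst)) hpq)
    rintro rfl
    exact hsv ht
  rcases hw s hs with h | h | h
  exacts [h, mem_pointed_of_swap_mem hvw h.1 h.2, key h]

theorem exists_covBy_hasZeroBlock (hxy : x < y) (hy : y.HasZeroBlock) :
    ∃ g, x ⋖ g ∧ g ≤ y ∧ g.HasZeroBlock := by
  by_cases hx : x.HasZeroBlock
  · obtain ⟨g, hg, hgy⟩ := exists_covBy_le_of_lt hxy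
    obtain ⟨a, ha⟩ := hx
    exact ⟨g, hg, hgy, a, ha.mono hg.le⟩
  -- The new zero block consists of two opposite blocks, and has the pointed element of that of `y`.
  obtain ⟨a, ha⟩ := hy
  obtain ⟨c, hc, hac⟩ := y.exists_pointed a
  have hcx : c ∈ x.pointed := hxy.le.2 hc
  obtain ⟨w, hwy, hxw, -, hw, -⟩ := exists_covBy_glue hxy.le hcx
    (swap_mem_pointed hcx fun h => hx ⟨c, h⟩) (by rcases c with c | c <;> simp) (ha.of_part hac)
    (Set.subset_univ _) (Or.inl (x.part.refl c)) hcx trivial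
  exact ⟨w, hxw, hwy, c, hw⟩

theorem isSemimodularRelTo_hasZeroBlock :
    IsSemimodularRelTo (HasZeroBlock : PointedPartitionB n → Prop) where
  mono h := fun ⟨a, ha⟩ => ⟨a, ha.mono h⟩
  exists_join := exists_join
  exists_covBy := exists_covBy_hasZeroBlock

end PointedPartitionB

/-- The maximal intervals `[⊥, M]` of the poset of pointed partitions of type `B_n`, where `M` is a
maximal element, are CL-shellable, and Cohen–Macaulay over `ℤ` and over every field. -/
theorem mainTheorem6 (n : ℕ) (hn : 1 ≤ n) (M : PointedPartitionB n) (hM : IsMax M) :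
    IsCLShellable (Set.Iic M) ∧
      IsCohenMacaulayPoset ℤ (Set.Iic M) ∧
      ∀ (K : Type*) [Field K], IsCohenMacaulayPoset K (Set.Iic M) := by
  have h := PointedPartitionB.isSemimodularRelTo_hasZeroBlock.iic M
  exact ⟨h.isCLShellable, h.isCohenMacaulayPoset ℤ, fun K _ => h.isCohenMacaulayPoset K⟩
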